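/- Let $k$ be a commutative ring and let $A$ and $L$ be (associative unital) $k$-algebras. Let $\mathcal C$ be an $A$-coring with coproduct $\Delta_{\mathcal C}(c)=c^{(1)}\otimes_A c^{(2)}$ and counit $\epsilon_{\mathcal C}$, and let $\mathcal D$ be an $L$-coring with coproduct $\Delta_{\mathcal D}(d)=d_{(1)}\otimes_L d_{(2)}$ and counit $\epsilon_{\mathcal D}$. Write $\mathcal M_L$ for the category of right $L$-modules, and $\mathcal M^{\mathcal C}$, $\mathcal M^{\mathcal D}$ for the categories of right comodules. Coactions of $\mathcal C$ are written $\varrho^M(m)=m^{[0]}\otimes_A m^{[1]}$. Let $\mathcal D$ be a pure right coring extension of $\mathcal C$. This means that $\mathcal C$ is an $A$-$L$ bimodule and a $\mathcal C$-$\mathcal D$ bicomodule, with left coaction $\Delta_{\mathcal C}$ and some right coaction $\tau_{\mathcal C}(c)=c_{[0]}\otimes_L c_{[1]}$, and that for every right $\mathcal C$-comodule $(M,\varrho^M)$ the equalizer $$M\xrightarrow{\ \varrho^M\ } M\otimes_A\mathcal C\rightrightarrows M\otimes_A\mathcal C\otimes_A\mathcal C$$ of $\varrho^M\otimes_A\mathcal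 C$ and $M\otimes_A\Delta_{\mathcal C}$ in $\mathcal M_L$ is preserved by $-\otimes_L\mathcal D\otimes_L\mathcal D$. Here $M$ is a right $L$-module via $ml=m^{[0]}\epsilon_{\mathcal C}(m^{[1]}l)$. By purity there is a unique map $\tau_M:M\to M\otimes_L\mathcal D$ with $(\varrho^M\otimes_L\mathcal D)\circ\tau_M=(M\otimes_A\tau_{\mathcal C})\circ\varrho^M$, and it is a right $\mathcal D$-coaction. This defines the $k$-linear functor $U=-\Box_{\mathcal C}\mathcal C:\mathcal M^{\mathcal C}\to\mathcal M^{\mathcal D}$, which leaves the underlying $k$-modules and maps unchanged. Let $\Sigma$ be an $L$-$\mathcal C$ bicomodule, that is, an $L$-$A$ bimodule and a right $\mathcal C$-comodule with left $L$-linear coaction. For a right $\mathcal C$-comodule $M$, the right $L$-module structure of $\mathrm{Hom}^{\mathcal C}(\Sigma,M)$ is $(\varphi l)(x)=\varphi(lx)$; let $V=\mathrm{Hom}^{\mathcal C}(\Sigma,-)\otimes_L\mathcal D:\mathcal M^{\mathcal C}\to\mathcal M^{\mathcal D}$, with coaction $\mathrm{Hom}^{\mathcal C}(\Sigma,M)\otimes_L\Delta_{\mathcal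 D}$ on the value at $M$. Let $T=\mathrm{End}^{\mathcal C}(\Sigma)$, with the $L$-bimodule structure $(lt)(x)=l\,t(x)$, $(tl)(x)=t(lx)$. Let $\Sigma^*=\mathrm{Hom}_A(\Sigma,A)$, an $A$-$L$ bimodule via $(a\xi l)(x)=a\,\xi(lx)$, and $$\widetilde Q=\{\,q\in{}_A\mathrm{Hom}_L(\mathcal C,\Sigma^*)\ |\ c^{(1)}q(c^{(2)})(x)=q(c)(x^{[0]})\,x^{[1]}\ \text{ for all }x\in\Sigma,\ c\in\mathcal C\,\}.$$ Then the following hold. (1) The $k$-modules ${}_L\mathrm{Hom}_L(\mathcal D,T)$ ($L$-bimodule maps), ${}^{\mathcal C}\mathrm{End}^{\mathcal D}(\mathcal C)^{op}$ (endomorphisms of the bicomodule $\mathcal C$), ${}_L\mathrm{Hom}^{\mathcal D}(\mathcal D,\Sigma)$ (left $L$-linear right $\mathcal D$-comodule maps $\mathcal D\to U\Sigma$) and $\widetilde Q$ form a Morita context over $k$, $$\widetilde{\mathbb M}(\Sigma)=\big({}_L\mathrm{Hom}_L(\mathcal D,T),\ {}^{\mathcal C}\mathrm{End}^{\mathcal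 D}(\mathcal C)^{op},\ {}_L\mathrm{Hom}^{\mathcal D}(\mathcal D,\Sigma),\ \widetilde Q,\ \blacklozenge,\ \lozenge\big),$$ in which the products, the bimodule structures and the connecting maps $\blacklozenge:\widetilde Q\otimes{}_L\mathrm{Hom}^{\mathcal D}(\mathcal D,\Sigma)\to{}^{\mathcal C}\mathrm{End}^{\mathcal D}(\mathcal C)^{op}$ and $\lozenge:{}_L\mathrm{Hom}^{\mathcal D}(\mathcal D,\Sigma)\otimes\widetilde Q\to{}_L\mathrm{Hom}_L(\mathcal D,T)$ (tensor products over the respective algebras of the context) are given, for $v,v'\in{}_L\mathrm{Hom}_L(\mathcal D,T)$, $u,u'\in{}^{\mathcal C}\mathrm{End}^{\mathcal D}(\mathcal C)$, $p\in{}_L\mathrm{Hom}^{\mathcal D}(\mathcal D,\Sigma)$, $q\in\widetilde Q$, $d\in\mathcal D$, $c\in\mathcal C$, by $$\begin{aligned} (vv')(d)&=v(d_{(1)})\,v'(d_{(2)}), & (uu')(c)&=u'(u(c)),\\ (vp)(d)&=v(d_{(1)})\big(p(d_{(2)})\big), & (pu)(d)&=p(d)^{[0]}\,\epsilon_{\mathcal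 C}\big(u(p(d)^{[1]})\big),\\ (qv)(c)&=q(c_{[0]})\,v(c_{[1]})=q(c_{[0]})\circ v(c_{[1]}), & (uq)(c)&=q(u(c)), \end{aligned}$$ $$(q\mathbin{\blacklozenge}p)(c)=c^{(1)}q\big({c^{(2)}}_{[0]}\big)\big(p({c^{(2)}}_{[1]})\big)=q(c_{[0]})\big(p(c_{[1]})^{[0]}\big)\,p(c_{[1]})^{[1]},$$ $$(p\mathbin{\lozenge}q)(d)=p(d)^{[0]}\,q\big(p(d)^{[1]}\big)(-).$$ (2) There are $k$-linear isomorphisms $$\begin{aligned} \alpha_1&:{}_L\mathrm{Hom}_L(\mathcal D,T)\to\mathrm{Nat}(V,V)^{op}, & \alpha_2&:{}^{\mathcal C}\mathrm{End}^{\mathcal D}(\mathcal C)^{op}\to\mathrm{Nat}(U,U)^{op},\\ \alpha_3&:{}_L\mathrm{Hom}^{\mathcal D}(\mathcal D,\Sigma)\to\mathrm{Nat}(V,U), & \alpha_4&:\widetilde Q\to\mathrm{Nat}(U,V) \end{aligned}$$ that constitute an isomorphism of Morita contexts from $\widetilde{\mathbb M}(\Sigma)$ to the context $\big(\mathrm{Nat}(V,V)^{op},\mathrm{Nat}(U,U)^{op},\mathrm{Nat}(V,U),\mathrm{Nat}(U,V)\big)$,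 all of whose products, actions and connecting maps are the opposite composition of natural transformations, $fg=g\circ f$. -/

import Mathlib

open CategoryTheory MulOpposite
open scoped TensorProduct

universe u

set_option linter.unusedSectionVars false

namespace CoringMorita

noncomputable section

/-! ### Tensor products over noncommutative algebras

Throughout, `k` is the commutative ground ring. A right `R`-module is a module over `Rᵐᵒᵖ`,
so that `op r • m` stands for `m r`. -/

section BalTensor

/-- The relations `m r ⊗ n = m ⊗ r n`. -/
def balRel (k R M N : Type u) [CommRing k] [Ring R]
    [AddCommGroup M] [Module k M] [Module Rᵐᵒᵖ M]
    [AddCommGroup N] [Module k N] [Module R N] : Submodule k (M ⊗[k] N) :=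
  Submodule.span k {x | ∃ (m : M) (r : R) (n : N), x = (op r • m) ⊗ₜ[k] n - m ⊗ₜ[k] (r • n)}

/-- The tensor product `M ⊗_R N` of a right and a left module over a `k`-algebra `R`. -/
def BalTensor (k R M N : Type u) [CommRing k] [Ring R]
    [AddCommGroup M] [Module k M] [Module Rᵐᵒᵖ M]
    [AddCommGroup N] [Module k N] [Module R N] : Type u :=
  (M ⊗[k] N) ⧸ balRel k R M N

namespace BalTensor

variable {k R M N P M' N' : Type u} [CommRing k] [Ring R]
  [AddCommGroup M] [Module k M] [Module Rᵐᵒᵖ M]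
  [AddCommGroup N] [Module k N] [Module R N]
  [AddCommGroup P] [Module k P]
  [AddCommGroup M'] [Module k M'] [Module Rᵐᵒᵖ M']
  [AddCommGroup N'] [Module k N'] [Module R N']

instance : AddCommGroup (BalTensor k R M N) :=
  inferInstanceAs (AddCommGroup ((M ⊗[k] N) ⧸ balRel k R M N))

instance instModuleBase : Module k (BalTensor k R M N) :=
  inferInstanceAs (Module k ((M ⊗[k] N) ⧸ balRel k R M N))

variable (k R M N) in
/-- The canonical projection of `M ⊗_k N` onto `M ⊗_R N`. -/
def proj : M ⊗[k] N →ₗ[k] BalTensor k R M N :=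
  (balRel k R M N).mkQ

variable (k R) in
/-- The pure tensor `m ⊗_R n`. -/
def tmul (m : M) (n : N) : BalTensor k R M N :=
  proj k R M N (m ⊗ₜ[k] n)

theorem smul_tmul (m : M) (r : R) (n : N) :
    tmul k R (op r • m) n = tmul k R m (r • n) := by
  unfold tmul
  rw [← sub_eq_zero, ← map_sub]
  exact (Submodule.Quotient.mk_eq_zero _).2 (Submodule.subset_span ⟨m, r, n, rfl⟩)

/-- The linear map out of `M ⊗_R N` given by an `R`-balanced bilinear map. -/
def lift (f : M →ₗ[k] N →ₗ[k] P) (hf : ∀ (m : M) (r : R) (n : N), f (op r • m) n = f m (r • n)) :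
    BalTensor k R M N →ₗ[k] P :=
  (balRel k R M N).liftQ (TensorProduct.lift f) <| by
    refine Submodule.span_le.2 ?_
    rintro _ ⟨m, r, n, rfl⟩
    simp [hf]

@[simp] theorem lift_tmul (f : M →ₗ[k] N →ₗ[k] P)
    (hf : ∀ (m : M) (r : R) (n : N), f (op r • m) n = f m (r • n)) (m : M) (n : N) :
    lift f hf (tmul k R m n) = f m n := (rfl)

theorem add_tmul (m m' : M) (n : N) :
    tmul k R (m + m') n = tmul k R m n + tmul k R m' n := by
  simp [tmul, TensorProduct.add_tmul]

theorem tmul_add (m : M) (n n' : N) :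
    tmul k R m (n + n') = tmul k R m n + tmul k R m n' := by
  simp [tmul, TensorProduct.tmul_add]

theorem base_smul_tmul (c : k) (m : M) (n : N) :
    tmul k R (c • m) n = c • tmul k R m n := by
  simp only [tmul, ← TensorProduct.smul_tmul', map_smul]

theorem base_tmul_smul (c : k) (m : M) (n : N) :
    tmul k R m (c • n) = c • tmul k R m n := by
  simp only [tmul, TensorProduct.tmul_smul, map_smul]

@[elab_as_elim]
theorem induction {p : BalTensor k R M N → Prop} (x : BalTensor k R M N)
    (zero : p 0) (tmul : ∀ m n, p (tmul k R m n)) (add : ∀ x y, p x → p y → p (x + y)) : p x := by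
  obtain ⟨y, rfl⟩ : ∃ y, proj k R M N y = x := (balRel k R M N).mkQ_surjective x
  induction y using TensorProduct.induction_on with
  | zero => rw [map_zero]; exact zero
  | tmul m n => exact tmul m n
  | add a b ha hb => rw [map_add]; exact add _ _ ha hb

theorem hom_ext {f g : BalTensor k R M N →ₗ[k] P}
    (h : ∀ m n, f (tmul k R m n) = g (tmul k R m n)) : f = g := by
  ext x
  induction x using BalTensor.induction with
  | zero => simp
  | tmul m n => exact h m n
  | add x y hx hy => simp [hx, hy]

variable (k R M N) in
/-- The universal balanced bilinear map. -/
def mk : M →ₗ[k] N →ₗ[k] BalTensor k R M N :=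
  LinearMap.mk₂ k (tmul k R) add_tmul base_smul_tmul tmul_add base_tmul_smul

@[simp] theorem mk_apply (m : M) (n : N) : mk k R M N m n = tmul k R m n := (rfl)

theorem zero_tmul (n : N) : tmul k R (0 : M) n = 0 := by
  rw [← mk_apply, map_zero, LinearMap.zero_apply]

theorem tmul_zero (m : M) : tmul k R m (0 : N) = 0 := by
  rw [← mk_apply, map_zero]

/-- `f ⊗_R N` for a right `R`-linear map `f`. -/
def mapLeft (f : M →ₗ[k] M') (hf : ∀ (r : R) (m : M), f (op r • m) = op r • f m) :
    BalTensor k R M N →ₗ[k] BalTensor k R M' N :=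
  lift ((mk k R M' N).comp f) fun m r n => by simp [hf, smul_tmul]

@[simp] theorem mapLeft_tmul (f : M →ₗ[k] M')
    (hf : ∀ (r : R) (m : M), f (op r • m) = op r • f m) (m : M) (n : N) :
    mapLeft f hf (tmul k R m n) = tmul k R (f m) n := (rfl)

/-- `M ⊗_R g` for a left `R`-linear map `g`. -/
def mapRight (g : N →ₗ[k] N') (hg : ∀ (r : R) (n : N), g (r • n) = r • g n) :
    BalTensor k R M N →ₗ[k] BalTensor k R M N' :=
  lift ((mk k R M N').compl₂ g) fun m r n => by simp [hg, smul_tmul]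

@[simp] theorem mapRight_tmul (g : N →ₗ[k] N')
    (hg : ∀ (r : R) (n : N), g (r • n) = r • g n) (m : M) (n : N) :
    mapRight g hg (tmul k R m n) = tmul k R m (g n) := (rfl)

/-- `m ⊗ n ↦ m f(n)` for a left `R`-linear map `f : N → R`. -/
def contractRight [Algebra k R] [IsScalarTower k Rᵐᵒᵖ M]
    (f : N →ₗ[k] R) (hf : ∀ (r : R) (n : N), f (r • n) = r * f n) :
    BalTensor k R M N →ₗ[k] M :=
  lift (LinearMap.mk₂ k (fun m n => op (f n) • m)
    (fun m m' n => by simp) (fun c m n => by rw [smul_comm])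
    (fun m n n' => by simp [add_smul]) (fun c m n => by simp)) fun m r n => by
      simp [hf, mul_smul]

@[simp] theorem contractRight_tmul [Algebra k R] [IsScalarTower k Rᵐᵒᵖ M]
    (f : N →ₗ[k] R) (hf : ∀ (r : R) (n : N), f (r • n) = r * f n) (m : M) (n : N) :
    contractRight f hf (tmul k R m n) = op (f n) • m := (rfl)

/-- `m ⊗ n ↦ f(m) n` for a right `R`-linear map `f : M → R`. -/
def contractLeft [Algebra k R] [IsScalarTower k R N]
    (f : M →ₗ[k] R) (hf : ∀ (r : R) (m : M), f (op r • m) = f m * r) :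
    BalTensor k R M N →ₗ[k] N :=
  lift (LinearMap.mk₂ k (fun m n => f m • n)
    (fun m m' n => by simp [add_smul]) (fun c m n => by simp)
    (fun m n n' => by simp) (fun c m n => by rw [smul_comm])) fun m r n => by
      simp [hf, mul_smul]

@[simp] theorem contractLeft_tmul [Algebra k R] [IsScalarTower k R N]
    (f : M →ₗ[k] R) (hf : ∀ (r : R) (m : M), f (op r • m) = f m * r) (m : M) (n : N) :
    contractLeft f hf (tmul k R m n) = f m • n := (rfl)

/-- The left `S`-module structure `s (m ⊗ n) = s m ⊗ n`, where `M` is an `S`-`R` bimodule. -/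
instance (priority := 200) instModuleLeft {S : Type u} [Ring S] [Module S M] [SMulCommClass S k M]
    [SMulCommClass S Rᵐᵒᵖ M] : Module S (BalTensor k R M N) where
  smul s := mapLeft (Module.toModuleEnd k (S := S) M s) fun r m => smul_comm s (op r) m
  one_smul x := by
    induction x using BalTensor.induction with
    | zero => exact map_zero _
    | tmul m n => exact (mapLeft_tmul _ _ m n).trans (by simp)
    | add x y hx hy => exact (map_add _ x y).trans (congrArg₂ _ hx hy)
  mul_smul s t x := by
    induction x using BalTensor.induction with
    | zero =>
      refine (map_zero _).trans (Eq.symm ((congrArg _ (map_zero _)).trans (map_zero _)))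
    | tmul m n =>
      refine (mapLeft_tmul _ _ m n).trans (Eq.symm ((congrArg _ (mapLeft_tmul _ _ m n)).trans ?_))
      exact (mapLeft_tmul _ _ _ n).trans (by simp [mul_smul])
    | add x y hx hy =>
      refine (map_add _ x y).trans ((congrArg₂ _ hx hy).trans (Eq.symm ?_))
      exact (congrArg _ (map_add _ x y)).trans (map_add _ _ _)
  smul_zero s := map_zero _
  smul_add s := map_add _
  add_smul s t x := by
    induction x using BalTensor.induction with
    | zero => exact (map_zero _).trans (Eq.symm ((congrArg₂ _ (map_zero _) (map_zero _)).trans (add_zero _)))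
    | tmul m n =>
      refine (mapLeft_tmul _ _ m n).trans (Eq.symm ((congrArg₂ _ (mapLeft_tmul _ _ m n)
        (mapLeft_tmul _ _ m n)).trans ?_))
      simp [add_smul, add_tmul]
    | add x y hx hy =>
      refine (map_add _ x y).trans ((congrArg₂ _ hx hy).trans (Eq.symm ?_))
      refine (congrArg₂ _ (map_add _ x y) (map_add _ x y)).trans ?_
      exact add_add_add_comm _ _ _ _
  zero_smul x := by
    induction x using BalTensor.induction with
    | zero => exact map_zero _
    | tmul m n =>
      refine (mapLeft_tmul _ _ m n).trans ?_
      simp [← mk_apply]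
    | add x y hx hy => exact (map_add _ x y).trans ((congrArg₂ _ hx hy).trans (add_zero _))

theorem left_smul_tmul {S : Type u} [Ring S] [Module S M] [SMulCommClass S k M]
    [SMulCommClass S Rᵐᵒᵖ M] (s : S) (m : M) (n : N) :
    s • tmul k R m n = tmul k R (s • m) n :=
  mapLeft_tmul _ _ m n

/-- The right `S`-module structure `(m ⊗ n) s = m ⊗ n s`, where `N` is an `R`-`S` bimodule. -/
instance (priority := 300) instModuleRight {S : Type u} [Ring S] [Module Sᵐᵒᵖ N]
    [SMulCommClass Sᵐᵒᵖ k N] [SMulCommClass R Sᵐᵒᵖ N] : Module Sᵐᵒᵖ (BalTensor k R M N) where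
  smul s := mapRight (Module.toModuleEnd k (S := Sᵐᵒᵖ) N s) fun r n => (smul_comm r s n).symm
  one_smul x := by
    induction x using BalTensor.induction with
    | zero => exact map_zero _
    | tmul m n => exact (mapRight_tmul _ _ m n).trans (by simp)
    | add x y hx hy => exact (map_add _ x y).trans (congrArg₂ _ hx hy)
  mul_smul s t x := by
    induction x using BalTensor.induction with
    | zero =>
      refine (map_zero _).trans (Eq.symm ((congrArg _ (map_zero _)).trans (map_zero _)))
    | tmul m n =>
      refine (mapRight_tmul _ _ m n).trans (Eq.symm ((congrArg _ (mapRight_tmul _ _ m n)).trans ?_))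
      exact (mapRight_tmul _ _ m _).trans (by simp [mul_smul])
    | add x y hx hy =>
      refine (map_add _ x y).trans ((congrArg₂ _ hx hy).trans (Eq.symm ?_))
      exact (congrArg _ (map_add _ x y)).trans (map_add _ _ _)
  smul_zero s := map_zero _
  smul_add s := map_add _
  add_smul s t x := by
    induction x using BalTensor.induction with
    | zero => exact (map_zero _).trans (Eq.symm ((congrArg₂ _ (map_zero _) (map_zero _)).trans (add_zero _)))
    | tmul m n =>
      refine (mapRight_tmul _ _ m n).trans (Eq.symm ((congrArg₂ _ (mapRight_tmul _ _ m n)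
        (mapRight_tmul _ _ m n)).trans ?_))
      simp [add_smul, tmul_add]
    | add x y hx hy =>
      refine (map_add _ x y).trans ((congrArg₂ _ hx hy).trans (Eq.symm ?_))
      refine (congrArg₂ _ (map_add _ x y) (map_add _ x y)).trans ?_
      exact add_add_add_comm _ _ _ _
  zero_smul x := by
    induction x using BalTensor.induction with
    | zero => exact map_zero _
    | tmul m n =>
      refine (mapRight_tmul _ _ m n).trans ?_
      simp [← mk_apply]
    | add x y hx hy => exact (map_add _ x y).trans ((congrArg₂ _ hx hy).trans (add_zero _))

theorem right_smul_tmul {S : Type u} [Ring S] [Module Sᵐᵒᵖ N]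
    [SMulCommClass Sᵐᵒᵖ k N] [SMulCommClass R Sᵐᵒᵖ N] (s : S) (m : M) (n : N) :
    op s • tmul k R m n = tmul k R m (op s • n) :=
  mapRight_tmul _ _ m n

instance {S : Type u} [Ring S] [Algebra k S] [Module S M] [IsScalarTower k S M]
    [SMulCommClass S Rᵐᵒᵖ M] : IsScalarTower k S (BalTensor k R M N) where
  smul_assoc c s x := by
    induction x using BalTensor.induction with
    | zero => simp
    | tmul m n => simp only [left_smul_tmul, smul_assoc, base_smul_tmul]
    | add x y hx hy => simp only [smul_add, hx, hy]

instance {S : Type u} [Ring S] [Algebra k S] [Module Sᵐᵒᵖ N] [IsScalarTower k Sᵐᵒᵖ N]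
    [SMulCommClass R Sᵐᵒᵖ N] : IsScalarTower k Sᵐᵒᵖ (BalTensor k R M N) where
  smul_assoc c s x := by
    induction x using BalTensor.induction with
    | zero => simp
    | tmul m n =>
      induction s using MulOpposite.rec' with | _ s
      rw [← op_smul, right_smul_tmul, right_smul_tmul, op_smul, smul_assoc, base_tmul_smul]
    | add x y hx hy => simp only [smul_add, hx, hy]

instance {S Q : Type u} [Ring S] [Ring Q] [Module S M] [SMulCommClass S k M]
    [SMulCommClass S Rᵐᵒᵖ M] [Module Qᵐᵒᵖ N]
    [SMulCommClass Qᵐᵒᵖ k N] [SMulCommClass R Qᵐᵒᵖ N] :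
    SMulCommClass S Qᵐᵒᵖ (BalTensor k R M N) where
  smul_comm s q x := by
    induction x using BalTensor.induction with
    | zero => simp
    | tmul m n =>
      induction q using MulOpposite.rec' with | _ q
      simp only [right_smul_tmul, left_smul_tmul]
    | add x y hx hy => simp only [smul_add, hx, hy]

section
variable {S X : Type u} [Ring S] [Module Sᵐᵒᵖ N] [SMulCommClass Sᵐᵒᵖ k N]
    [SMulCommClass R k N] [SMulCommClass R Sᵐᵒᵖ N] [AddCommGroup X] [Module k X] [Module S X]

/-- The auxiliary map `m ⊗ n ↦ m ⊗ (n ⊗ x)` for fixed `x`. -/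
def assocAux : X →ₗ[k] BalTensor k R M N →ₗ[k] BalTensor k R M (BalTensor k S N X) :=
  LinearMap.mk₂ k (fun x y => mapRight ((mk k S N X).flip x)
      (fun r n => by simp [left_smul_tmul]) y)
    (fun x x' y => by
      induction y using BalTensor.induction with
      | zero => simp
      | tmul m n => simp [tmul_add]
      | add y z hy hz => simp only [map_add] at hy hz ⊢; rw [hy, hz]; abel)
    (fun c x y => by
      induction y using BalTensor.induction with
      | zero => simp
      | tmul m n => simp [base_tmul_smul]
      | add y z hy hz => simp only [map_add, smul_add] at hy hz ⊢; rw [hy, hz])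
    (fun _ _ _ => map_add _ _ _) (fun _ _ _ => map_smul _ _ _)

@[simp] theorem assocAux_tmul (x : X) (m : M) (n : N) :
    assocAux (S := S) x (tmul k R m n) = tmul k R m (tmul k S n x) := (rfl)

/-- The map `(m ⊗ n) ⊗ x ↦ m ⊗ (n ⊗ x)`. -/
def assocHom : BalTensor k S (BalTensor k R M N) X →ₗ[k] BalTensor k R M (BalTensor k S N X) :=
  lift assocAux.flip fun y s x => by
    induction y using BalTensor.induction with
    | zero => simp
    | tmul m n => simp [right_smul_tmul, smul_tmul]
    | add y z hy hz => simp only [smul_add, map_add, LinearMap.add_apply, hy, hz]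

/-- The auxiliary map `n ⊗ x ↦ (m ⊗ n) ⊗ x` for fixed `m`. -/
def assocInvAux : M →ₗ[k] BalTensor k S N X →ₗ[k] BalTensor k S (BalTensor k R M N) X :=
  LinearMap.mk₂ k (fun m y => mapLeft (mk k R M N m)
      (fun s n => by simp [right_smul_tmul]) y)
    (fun x x' y => by
      induction y using BalTensor.induction with
      | zero => simp
      | tmul m n => simp [add_tmul]
      | add y z hy hz => simp only [map_add] at hy hz ⊢; rw [hy, hz]; abel)
    (fun c x y => by
      induction y using BalTensor.induction with
      | zero => simp
      | tmul m n => simp [base_smul_tmul]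
      | add y z hy hz => simp only [map_add, smul_add] at hy hz ⊢; rw [hy, hz])
    (fun _ _ _ => map_add _ _ _) (fun _ _ _ => map_smul _ _ _)

@[simp] theorem assocInvAux_tmul (m : M) (n : N) (x : X) :
    assocInvAux (R := R) m (tmul k S n x) = tmul k S (tmul k R m n) x := (rfl)

/-- The map `m ⊗ (n ⊗ x) ↦ (m ⊗ n) ⊗ x`. -/
def assocInv : BalTensor k R M (BalTensor k S N X) →ₗ[k] BalTensor k S (BalTensor k R M N) X :=
  lift assocInvAux fun m r y => by
    induction y using BalTensor.induction with
    | zero => simp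
    | tmul n x => simp [left_smul_tmul, smul_tmul]
    | add y z hy hz => simp only [smul_add, map_add, hy, hz]

theorem assocHom_tmul (m : M) (n : N) (x : X) :
    assocHom (tmul k S (tmul k R m n) x) = tmul k R m (tmul k S n x) := (rfl)

theorem assocInv_tmul (m : M) (n : N) (x : X) :
    assocInv (tmul k R m (tmul k S n x)) = tmul k S (tmul k R m n) x := (rfl)

theorem tmul_induction_left {p : BalTensor k S (BalTensor k R M N) X → Prop}
    (z : BalTensor k S (BalTensor k R M N) X) (zero : p 0)
    (tmul : ∀ m n x, p (tmul k S (tmul k R m n) x)) (add : ∀ x y, p x → p y → p (x + y)) : p z := by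
  induction z using BalTensor.induction with
  | zero => exact zero
  | add _ _ h h' => exact add _ _ h h'
  | tmul y x =>
    induction y using BalTensor.induction with
    | zero => rw [← mk_apply, map_zero]; exact zero
    | add _ _ h h' => rw [add_tmul]; exact add _ _ h h'
    | tmul m n => exact tmul m n x

theorem tmul_induction_right {p : BalTensor k R M (BalTensor k S N X) → Prop}
    (z : BalTensor k R M (BalTensor k S N X)) (zero : p 0)
    (tmul : ∀ m n x, p (tmul k R m (tmul k S n x))) (add : ∀ x y, p x → p y → p (x + y)) : p z := by
  induction z using BalTensor.induction with
  | zero => exact zero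
  | add _ _ h h' => exact add _ _ h h'
  | tmul m y =>
    induction y using BalTensor.induction with
    | zero => rw [← mk_apply, map_zero]; exact zero
    | add _ _ h h' => rw [tmul_add]; exact add _ _ h h'
    | tmul n x => exact tmul m n x

/-- The canonical isomorphism `(M ⊗_R N) ⊗_S X → M ⊗_R (N ⊗_S X)`. -/
def assoc : BalTensor k S (BalTensor k R M N) X ≃ₗ[k] BalTensor k R M (BalTensor k S N X) :=
  { assocHom with
    invFun := assocInv
    left_inv := fun z => by
      change assocInv (assocHom z) = z
      induction z using tmul_induction_left with
      | zero => rw [map_zero, map_zero]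
      | tmul m n x => rfl
      | add y z hy hz => rw [map_add, map_add, hy, hz]
    right_inv := fun z => by
      change assocHom (assocInv z) = z
      induction z using tmul_induction_right with
      | zero => rw [map_zero, map_zero]
      | tmul m n x => rfl
      | add y z hy hz => rw [map_add, map_add, hy, hz] }

@[simp] theorem assoc_tmul (m : M) (n : N) (x : X) :
    assoc (tmul k S (tmul k R m n) x) = tmul k R m (tmul k S n x) := (rfl)

@[simp] theorem assoc_symm_tmul (m : M) (n : N) (x : X) :
    assoc.symm (tmul k R m (tmul k S n x)) = tmul k S (tmul k R m n) x := (rfl)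

end

end BalTensor

end BalTensor

section Naturality

namespace BalTensor

variable {k R S M N X M' N' M'' X' : Type u} [CommRing k] [Ring R] [Ring S]
  [AddCommGroup M] [Module k M] [Module Rᵐᵒᵖ M]
  [AddCommGroup M'] [Module k M'] [Module Rᵐᵒᵖ M']
  [AddCommGroup M''] [Module k M''] [Module Rᵐᵒᵖ M'']
  [AddCommGroup N] [Module k N] [Module R N]
  [AddCommGroup N'] [Module k N'] [Module R N']

theorem mapLeft_congr {f g : M →ₗ[k] M'} (h : f = g)
    (hf : ∀ (r : R) (m : M), f (op r • m) = op r • f m)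
    (hg : ∀ (r : R) (m : M), g (op r • m) = op r • g m) (x : BalTensor k R M N) :
    mapLeft f hf x = mapLeft g hg x := by
  subst h; rfl

theorem mapLeft_id (hf : ∀ (r : R) (m : M), (LinearMap.id (R := k) : M →ₗ[k] M) (op r • m) =
    op r • (LinearMap.id (R := k) : M →ₗ[k] M) m) (x : BalTensor k R M N) :
    mapLeft LinearMap.id hf x = x := by
  induction x using BalTensor.induction with
  | zero => simp
  | tmul m n => simp
  | add y z hy hz => rw [map_add, hy, hz]

theorem mapLeft_mapLeft (f : M →ₗ[k] M') (hf : ∀ (r : R) (m : M), f (op r • m) = op r • f m)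
    (g : M' →ₗ[k] M'') (hg : ∀ (r : R) (m : M'), g (op r • m) = op r • g m)
    (x : BalTensor k R M N) :
    mapLeft g hg (mapLeft f hf x) =
      mapLeft (g.comp f) (fun r m => by simp [hf, hg]) x := by
  induction x using BalTensor.induction with
  | zero => simp
  | tmul m n => simp
  | add y z hy hz => simp only [map_add, hy, hz]

theorem mapLeft_mapRight (f : M →ₗ[k] M') (hf : ∀ (r : R) (m : M), f (op r • m) = op r • f m)
    (g : N →ₗ[k] N') (hg : ∀ (r : R) (n : N), g (r • n) = r • g n) (x : BalTensor k R M N) :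
    mapLeft f hf (mapRight g hg x) = mapRight g hg (mapLeft f hf x) := by
  induction x using BalTensor.induction with
  | zero => simp
  | tmul m n => simp
  | add y z hy hz => simp only [map_add, hy, hz]

theorem mapLeft_op_smul [Module Sᵐᵒᵖ N] [SMulCommClass Sᵐᵒᵖ k N] [SMulCommClass R Sᵐᵒᵖ N]
    (f : M →ₗ[k] M') (hf : ∀ (r : R) (m : M), f (op r • m) = op r • f m) (s : S)
    (x : BalTensor k R M N) : mapLeft f hf (op s • x) = op s • mapLeft f hf x := by
  induction x using BalTensor.induction with
  | zero => simp
  | tmul m n => simp [right_smul_tmul]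
  | add y z hy hz => simp only [map_add, smul_add, hy, hz]

theorem mapRight_op_smul [Module Sᵐᵒᵖ N] [SMulCommClass Sᵐᵒᵖ k N] [SMulCommClass R Sᵐᵒᵖ N]
    [Module Sᵐᵒᵖ N'] [SMulCommClass Sᵐᵒᵖ k N'] [SMulCommClass R Sᵐᵒᵖ N']
    (g : N →ₗ[k] N') (hg : ∀ (r : R) (n : N), g (r • n) = r • g n)
    (hS : ∀ (s : S) (n : N), g (op s • n) = op s • g n) (s : S)
    (x : BalTensor k R M N) : mapRight g hg (op s • x) = op s • mapRight g hg x := by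
  induction x using BalTensor.induction with
  | zero => simp
  | tmul m n => simp [right_smul_tmul, hS]
  | add y z hy hz => simp only [map_add, smul_add, hy, hz]

theorem contractRight_mapLeft [Algebra k R] [IsScalarTower k Rᵐᵒᵖ M] [IsScalarTower k Rᵐᵒᵖ M']
    (f : N →ₗ[k] R) (hf : ∀ (r : R) (n : N), f (r • n) = r * f n)
    (g : M →ₗ[k] M') (hg : ∀ (r : R) (m : M), g (op r • m) = op r • g m)
    (x : BalTensor k R M N) :
    contractRight f hf (mapLeft g hg x) = g (contractRight f hf x) := by
  induction x using BalTensor.induction with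
  | zero => simp
  | tmul m n => simp [hg]
  | add y z hy hz => simp only [map_add, hy, hz]

theorem contractRight_smul [Algebra k R] [IsScalarTower k Rᵐᵒᵖ M]
    [Module S M] [SMulCommClass S k M] [SMulCommClass S Rᵐᵒᵖ M]
    (f : N →ₗ[k] R) (hf : ∀ (r : R) (n : N), f (r • n) = r * f n) (s : S)
    (x : BalTensor k R M N) :
    contractRight f hf (s • x) = s • contractRight f hf x := by
  induction x using BalTensor.induction with
  | zero => simp
  | tmul m n => simp [left_smul_tmul, smul_comm]
  | add y z hy hz => simp only [map_add, smul_add, hy, hz]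

section
variable [Module Sᵐᵒᵖ N] [SMulCommClass Sᵐᵒᵖ k N]
    [SMulCommClass R k N] [SMulCommClass R Sᵐᵒᵖ N] [AddCommGroup X] [Module k X] [Module S X]
    [AddCommGroup X'] [Module k X'] [Module S X']

theorem assoc_mapLeft_mapLeft (f : M →ₗ[k] M')
    (hf : ∀ (r : R) (m : M), f (op r • m) = op r • f m)
    (z : BalTensor k S (BalTensor k R M N) X) :
    assoc (mapLeft (mapLeft f hf) (mapLeft_op_smul f hf) z) = mapLeft f hf (assoc z) := by
  induction z using tmul_induction_left with
  | zero => simp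
  | tmul m n x => simp
  | add y z hy hz => simp only [map_add, hy, hz]

theorem assoc_mapLeft_mapRight
    [Module Sᵐᵒᵖ N'] [SMulCommClass Sᵐᵒᵖ k N'] [SMulCommClass R k N'] [SMulCommClass R Sᵐᵒᵖ N']
    (g : N →ₗ[k] N') (hg : ∀ (r : R) (n : N), g (r • n) = r • g n)
    (hS : ∀ (s : S) (n : N), g (op s • n) = op s • g n)
    (z : BalTensor k S (BalTensor k R M N) X) :
    assoc (mapLeft (mapRight g hg) (mapRight_op_smul g hg hS) z) =
      mapRight (mapLeft g hS) (fun r y => by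
        induction y using BalTensor.induction with
        | zero => simp
        | tmul n x => simp [left_smul_tmul, hg]
        | add y z hy hz => simp only [map_add, smul_add, hy, hz]) (assoc z) := by
  induction z using tmul_induction_left with
  | zero => simp
  | tmul m n x => simp
  | add y z hy hz => simp only [map_add, hy, hz]

theorem mapRight_smul
    (g : X →ₗ[k] X') (hg : ∀ (s : S) (x : X), g (s • x) = s • g x) (r : R)
    (y : BalTensor k S N X) : mapRight g hg (r • y) = r • mapRight g hg y := by
  induction y using BalTensor.induction with
  | zero => simp
  | tmul n x => simp [left_smul_tmul]
  | add y z hy hz => simp only [map_add, smul_add, hy, hz]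

end

end BalTensor

end Naturality

/-! ### Corings and comodules -/

section Comodules

open BalTensor

/-- A coring over the `k`-algebra `A`: a coalgebra in the category of `A`-`A` bimodules. -/
structure Coring (k A : Type u) [CommRing k] [Ring A] [Algebra k A] where
  carrier : Type u
  [addCommGroup : AddCommGroup carrier]
  [module : Module k carrier]
  [moduleLeft : Module A carrier]
  [moduleRight : Module Aᵐᵒᵖ carrier]
  [towerLeft : IsScalarTower k A carrier]
  [towerRight : IsScalarTower k Aᵐᵒᵖ carrier]
  [bimodule : SMulCommClass A Aᵐᵒᵖ carrier]
  comul : carrier →ₗ[k] BalTensor k A carrier carrier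
  comul_smul : ∀ (a : A) (c : carrier), comul (a • c) = a • comul c
  comul_op_smul : ∀ (a : A) (c : carrier), comul (op a • c) = op a • comul c
  counit : carrier →ₗ[k] A
  counit_smul : ∀ (a : A) (c : carrier), counit (a • c) = a * counit c
  counit_op_smul : ∀ (a : A) (c : carrier), counit (op a • c) = counit c * a
  coassoc : ∀ c : carrier, assoc (mapLeft comul comul_op_smul (comul c)) =
    mapRight comul comul_smul (comul c)
  counit_comul : ∀ c : carrier, contractLeft counit counit_op_smul (comul c) = c
  comul_counit : ∀ c : carrier, contractRight counit counit_smul (comul c) = c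

attribute [instance] Coring.addCommGroup Coring.module Coring.moduleLeft Coring.moduleRight
  Coring.towerLeft Coring.towerRight Coring.bimodule

variable {k A : Type u} [CommRing k] [Ring A] [Algebra k A]

/-- A right comodule over the `A`-coring `C`. -/
structure RComod (C : Coring k A) where
  carrier : Type u
  [addCommGroup : AddCommGroup carrier]
  [module : Module k carrier]
  [moduleRight : Module Aᵐᵒᵖ carrier]
  [towerRight : IsScalarTower k Aᵐᵒᵖ carrier]
  coact : carrier →ₗ[k] BalTensor k A carrier C.carrier
  coact_op_smul : ∀ (a : A) (m : carrier), coact (op a • m) = op a • coact m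
  coassoc : ∀ m : carrier, assoc (mapLeft coact coact_op_smul (coact m)) =
    mapRight C.comul C.comul_smul (coact m)
  counit : ∀ m : carrier, contractRight C.counit C.counit_smul (coact m) = m

attribute [instance] RComod.addCommGroup RComod.module RComod.moduleRight RComod.towerRight

namespace RComod

variable {C : Coring k A}

/-- The `k`-module `Hom^C(M, N)` of right `A`-linear maps `f` with `ρ ∘ f = (f ⊗ C) ∘ ρ`. -/
def homs (M N : RComod C) : Submodule k (M.carrier →ₗ[k] N.carrier) where
  carrier := {f | ∃ hf : ∀ (a : A) (m : M.carrier), f (op a • m) = op a • f m,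
    ∀ m, N.coact (f m) = mapLeft f hf (M.coact m)}
  zero_mem' := ⟨fun a m => by simp, fun m => by
    generalize M.coact m = x
    induction x using BalTensor.induction with
    | zero => simp
    | tmul m c => simp [zero_tmul]
    | add y z hy hz => rw [map_add, ← hy, ← hz]; simp⟩
  add_mem' := by
    rintro f g ⟨hf, hf'⟩ ⟨hg, hg'⟩
    refine ⟨fun a m => by simp [hf, hg], fun m => ?_⟩
    rw [LinearMap.add_apply, map_add, hf', hg']
    generalize M.coact m = x
    induction x using BalTensor.induction with
    | zero => simp
    | tmul m c => simp [add_tmul]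
    | add y z hy hz => simp only [map_add, ← hy, ← hz]; abel
  smul_mem' := by
    rintro r f ⟨hf, hf'⟩
    refine ⟨fun a m => by simp only [LinearMap.smul_apply, hf]; rw [smul_comm], fun m => ?_⟩
    rw [LinearMap.smul_apply, map_smul, hf']
    generalize M.coact m = x
    induction x using BalTensor.induction with
    | zero => simp
    | tmul m c => simp [base_smul_tmul]
    | add y z hy hz => simp only [map_add, ← hy, ← hz, smul_add]

/-- The category `M^C` of right `C`-comodules. -/
instance : Category (RComod C) where
  Hom M N := homs M N
  id M := ⟨LinearMap.id, fun _ _ => rfl, fun m => (mapLeft_id _ _).symm⟩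
  comp {M N P} f g := ⟨g.1.comp f.1, fun a m => by
      obtain ⟨hf, -⟩ := f.2
      obtain ⟨hg, -⟩ := g.2
      simp [hf, hg], fun m => by
      obtain ⟨hf, hf'⟩ := f.2
      obtain ⟨hg, hg'⟩ := g.2
      rw [LinearMap.comp_apply, hg', hf', mapLeft_mapLeft]⟩
  id_comp f := rfl
  comp_id f := rfl
  assoc f g h := rfl

/-- The linear map underlying a morphism of comodules. -/
def Hom.lin {M N : RComod C} (f : M ⟶ N) : M.carrier →ₗ[k] N.carrier :=
  Subtype.val f

theorem Hom.lin_op_smul {M N : RComod C} (f : M ⟶ N) (a : A) (m : M.carrier) :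
    Hom.lin f (op a • m) = op a • Hom.lin f m :=
  f.2.1 a m

theorem Hom.coact_lin {M N : RComod C} (f : M ⟶ N) (m : M.carrier) :
    N.coact (Hom.lin f m) = mapLeft (Hom.lin f) (Hom.lin_op_smul f) (M.coact m) :=
  f.2.2 m

/-- A morphism of comodules from a colinear map. -/
def Hom.mk {M N : RComod C} (f : M.carrier →ₗ[k] N.carrier)
    (hf : ∀ (a : A) (m : M.carrier), f (op a • m) = op a • f m)
    (hf' : ∀ m, N.coact (f m) = mapLeft f hf (M.coact m)) : M ⟶ N :=
  ⟨f, hf, hf'⟩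

@[simp] theorem Hom.lin_mk {M N : RComod C} (f : M.carrier →ₗ[k] N.carrier)
    (hf : ∀ (a : A) (m : M.carrier), f (op a • m) = op a • f m)
    (hf' : ∀ m, N.coact (f m) = mapLeft f hf (M.coact m)) : Hom.lin (Hom.mk f hf hf') = f := (rfl)

@[ext] theorem hom_ext {M N : RComod C} {f g : M ⟶ N} (h : ∀ m, Hom.lin f m = Hom.lin g m) :
    f = g :=
  Subtype.ext (LinearMap.ext h)

instance : Preadditive (RComod C) where
  homGroup M N := inferInstanceAs (AddCommGroup (homs M N))
  add_comp _ _ _ _ _ h := Subtype.ext (LinearMap.ext fun _ => map_add h.1 _ _)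
  comp_add _ _ _ _ _ _ := rfl

instance : Linear k (RComod C) where
  homModule M N := inferInstanceAs (Module k (homs M N))
  smul_comp _ _ _ r _ g := Subtype.ext (LinearMap.ext fun _ => map_smul g.1 r _)
  comp_smul _ _ _ _ _ _ := rfl

@[simp] theorem Hom.lin_add {M N : RComod C} (f g : M ⟶ N) :
    Hom.lin (f + g) = Hom.lin f + Hom.lin g := (rfl)

@[simp] theorem Hom.lin_zero {M N : RComod C} :
    Hom.lin (0 : M ⟶ N) = 0 := (rfl)

@[simp] theorem Hom.lin_smul {M N : RComod C} (r : k) (f : M ⟶ N) :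
    Hom.lin (r • f) = r • Hom.lin f := (rfl)

@[simp] theorem Hom.lin_comp {M N P : RComod C} (f : M ⟶ N) (g : N ⟶ P) (m : M.carrier) :
    Hom.lin (f ≫ g) m = Hom.lin g (Hom.lin f m) := (rfl)

@[simp] theorem Hom.lin_id {M : RComod C} (m : M.carrier) :
    Hom.lin (𝟙 M) m = m := (rfl)

end RComod

/-- An `L`-`C` bicomodule: a right `C`-comodule and left `L`-module whose coaction is left
`L`-linear. -/
structure BiComod (L : Type u) [Ring L] [Algebra k L] (C : Coring k A) extends RComod C where
  [moduleLeft : Module L carrier]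
  [towerLeft : IsScalarTower k L carrier]
  [bimodule : SMulCommClass L Aᵐᵒᵖ carrier]
  coact_smul : ∀ (l : L) (x : carrier), coact (l • x) = l • coact x

attribute [instance] BiComod.moduleLeft BiComod.towerLeft BiComod.bimodule

/-- The data making the `L`-coring `D` a right extension of the `A`-coring `C`: a right
`D`-coaction `τ` on the `A`-`L` bimodule `C` for which `C` is a `C`-`D` bicomodule with respect to
the left regular coaction. -/
structure CoringExtension {L : Type u} [Ring L] [Algebra k L] (C : Coring k A) (D : Coring k L)
    [Module Lᵐᵒᵖ C.carrier] [IsScalarTower k Lᵐᵒᵖ C.carrier]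
    [SMulCommClass A Lᵐᵒᵖ C.carrier] where
  coact : C.carrier →ₗ[k] BalTensor k L C.carrier D.carrier
  coact_op_smul : ∀ (l : L) (c : C.carrier), coact (op l • c) = op l • coact c
  coassoc : ∀ c : C.carrier, assoc (mapLeft coact coact_op_smul (coact c)) =
    mapRight D.comul D.comul_smul (coact c)
  counit : ∀ c : C.carrier, contractRight D.counit D.counit_smul (coact c) = c
  coact_smul : ∀ (a : A) (c : C.carrier), coact (a • c) = a • coact c
  comul_op_smul : ∀ (l : L) (c : C.carrier), C.comul (op l • c) = op l • C.comul c
  compat : ∀ c : C.carrier, assoc (mapLeft C.comul comul_op_smul (coact c)) =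
    mapRight coact coact_smul (C.comul c)

end Comodules

section Induced

/-! ### Induced coactions: if `N` is an `R`-`S` bimodule with a left `R`-linear right `D`-coaction,
then `M ⊗_R N` is a right `D`-comodule. -/

namespace BalTensor

variable {k R S : Type u} [CommRing k] [Ring R] [Algebra k R] [Ring S] [Algebra k S]

theorem contractRight_comp {M N N' : Type u}
    [AddCommGroup M] [Module k M] [Module Rᵐᵒᵖ M] [IsScalarTower k Rᵐᵒᵖ M]
    [AddCommGroup N] [Module k N] [Module R N] [AddCommGroup N'] [Module k N'] [Module R N']
    (f : N' →ₗ[k] R) (hf : ∀ (r : R) (n : N'), f (r • n) = r * f n)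
    (g : N →ₗ[k] N') (hg : ∀ (r : R) (n : N), g (r • n) = r • g n) (x : BalTensor k R M N) :
    contractRight (f.comp g) (fun r n => by simp [hf, hg]) x =
      contractRight f hf (mapRight g hg x) := by
  induction x using BalTensor.induction with
  | zero => simp
  | tmul m n => simp
  | add y z hy hz => simp only [map_add, hy, hz]

variable {M M' N N' X : Type u}
  [AddCommGroup M] [Module k M] [Module Rᵐᵒᵖ M]
  [AddCommGroup M'] [Module k M'] [Module Rᵐᵒᵖ M']
  [AddCommGroup N] [Module k N] [Module R N] [Module Sᵐᵒᵖ N] [IsScalarTower k R N]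
  [IsScalarTower k Sᵐᵒᵖ N] [SMulCommClass R Sᵐᵒᵖ N]
  [AddCommGroup N'] [Module k N'] [Module R N'] [Module Sᵐᵒᵖ N'] [IsScalarTower k R N']
  [IsScalarTower k Sᵐᵒᵖ N'] [SMulCommClass R Sᵐᵒᵖ N']
  [AddCommGroup X] [Module k X] [Module S X]

theorem contractRight_assoc (f : X →ₗ[k] S) (hf : ∀ (s : S) (x : X), f (s • x) = s * f x)
    (z : BalTensor k S (BalTensor k R M N) X) :
    contractRight f hf z = mapRight (contractRight f hf) (contractRight_smul f hf) (assoc z) := by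
  induction z using tmul_induction_left with
  | zero => simp
  | tmul m n x => simp [right_smul_tmul]
  | add y z hy hz => simp only [map_add, hy, hz]

theorem assoc_op_smul {Q : Type u} [Ring Q] [Algebra k Q] [Module Qᵐᵒᵖ X] [IsScalarTower k Qᵐᵒᵖ X]
    [SMulCommClass S Qᵐᵒᵖ X] (q : Q) (z : BalTensor k S (BalTensor k R M N) X) :
    assoc (op q • z) = op q • assoc z := by
  induction z using tmul_induction_left with
  | zero => simp
  | tmul m n x => simp [right_smul_tmul]
  | add y z hy hz => simp only [map_add, smul_add, hy, hz]

theorem assoc_symm_op_smul {Q : Type u} [Ring Q] [Algebra k Q] [Module Qᵐᵒᵖ X]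
    [IsScalarTower k Qᵐᵒᵖ X] [SMulCommClass S Qᵐᵒᵖ X] (q : Q)
    (z : BalTensor k R M (BalTensor k S N X)) :
    assoc.symm (op q • z) = op q • assoc.symm z := by
  rw [LinearEquiv.symm_apply_eq, assoc_op_smul, LinearEquiv.apply_symm_apply]

variable {D : Coring k S}

variable (M) in
/-- The coaction `m ⊗ n ↦ (m ⊗ n₀) ⊗ n₁` on `M ⊗_R N`. -/
def tensorCoact (τ : N →ₗ[k] BalTensor k S N D.carrier)
    (hR : ∀ (r : R) (n : N), τ (r • n) = r • τ n) :
    BalTensor k R M N →ₗ[k] BalTensor k S (BalTensor k R M N) D.carrier :=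
  assoc.symm.toLinearMap.comp (mapRight τ hR)

theorem tensorCoact_tmul (τ : N →ₗ[k] BalTensor k S N D.carrier)
    (hR : ∀ (r : R) (n : N), τ (r • n) = r • τ n) (m : M) (n : N) :
    tensorCoact M τ hR (tmul k R m n) = assoc.symm (tmul k R m (τ n)) := by
  simp [tensorCoact]

theorem tensorCoact_op_smul (τ : N →ₗ[k] BalTensor k S N D.carrier)
    (hR : ∀ (r : R) (n : N), τ (r • n) = r • τ n)
    (hS : ∀ (s : S) (n : N), τ (op s • n) = op s • τ n) (s : S) (z : BalTensor k R M N) :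
    tensorCoact M τ hR (op s • z) = op s • tensorCoact M τ hR z := by
  simp only [tensorCoact, LinearMap.comp_apply, LinearEquiv.coe_coe]
  rw [mapRight_op_smul τ hR hS, assoc_symm_op_smul]

theorem tensorCoact_smul {Q : Type u} [Ring Q] [Algebra k Q] [Module Q M] [IsScalarTower k Q M]
    [SMulCommClass Q Rᵐᵒᵖ M] (τ : N →ₗ[k] BalTensor k S N D.carrier)
    (hR : ∀ (r : R) (n : N), τ (r • n) = r • τ n) (q : Q) (z : BalTensor k R M N) :
    tensorCoact M τ hR (q • z) = q • tensorCoact M τ hR z := by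
  induction z using BalTensor.induction with
  | zero => simp
  | add y z hy hz => simp only [map_add, smul_add, hy, hz]
  | tmul m n =>
    rw [left_smul_tmul, tensorCoact_tmul, tensorCoact_tmul]
    generalize τ n = w
    induction w using BalTensor.induction with
    | zero => simp [tmul_zero]
    | tmul n d => simp [left_smul_tmul]
    | add y z hy hz => simp only [tmul_add, map_add, smul_add, hy, hz]

theorem tensorCoact_coassoc (τ : N →ₗ[k] BalTensor k S N D.carrier)
    (hR : ∀ (r : R) (n : N), τ (r • n) = r • τ n)
    (hS : ∀ (s : S) (n : N), τ (op s • n) = op s • τ n)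
    (hτ : ∀ n : N, assoc (mapLeft τ hS (τ n)) = mapRight D.comul D.comul_smul (τ n))
    (z : BalTensor k R M N) :
    assoc (mapLeft (tensorCoact M τ hR) (tensorCoact_op_smul τ hR hS) (tensorCoact M τ hR z)) =
      mapRight D.comul D.comul_smul (tensorCoact M τ hR z) := by
  induction z using BalTensor.induction with
  | zero => simp
  | add y z hy hz => simp only [map_add, hy, hz]
  | tmul m n =>
    have h1 : ∀ w : BalTensor k S N D.carrier,
        assoc (mapLeft (tensorCoact M τ hR) (tensorCoact_op_smul τ hR hS)
          (assoc.symm (tmul k R m w))) = assoc.symm (tmul k R m (assoc (mapLeft τ hS w))) := by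
      intro w
      induction w using BalTensor.induction with
      | zero => simp [tmul_zero]
      | add y z hy hz => simp only [map_add, tmul_add, hy, hz]
      | tmul n d =>
        rw [assoc_symm_tmul, mapLeft_tmul, mapLeft_tmul, tensorCoact_tmul]
        generalize τ n = v
        induction v using BalTensor.induction with
        | zero => simp [tmul_zero, zero_tmul]
        | add y z hy hz => simp only [map_add, tmul_add, add_tmul, hy, hz]
        | tmul n' d' => simp
    have h2 : ∀ w : BalTensor k S N D.carrier,
        mapRight D.comul D.comul_smul (assoc.symm (tmul k R m w)) =
          assoc.symm (tmul k R m (mapRight D.comul D.comul_smul w)) := by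
      intro w
      induction w using BalTensor.induction with
      | zero => simp [tmul_zero]
      | add y z hy hz => simp only [map_add, tmul_add, hy, hz]
      | tmul n d =>
        rw [assoc_symm_tmul, mapRight_tmul, mapRight_tmul]
        generalize D.comul d = v
        induction v using BalTensor.induction with
        | zero => simp [tmul_zero]
        | add y z hy hz => simp only [map_add, tmul_add, hy, hz]
        | tmul n' d' => simp
    rw [tensorCoact_tmul, h1, h2, hτ]

theorem tensorCoact_counit (τ : N →ₗ[k] BalTensor k S N D.carrier)
    (hR : ∀ (r : R) (n : N), τ (r • n) = r • τ n)
    (hτ : ∀ n : N, contractRight D.counit D.counit_smul (τ n) = n)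
    (z : BalTensor k R M N) :
    contractRight D.counit D.counit_smul (tensorCoact M τ hR z) = z := by
  induction z using BalTensor.induction with
  | zero => simp
  | add y z hy hz => simp only [map_add, hy, hz]
  | tmul m n =>
    rw [contractRight_assoc, tensorCoact_tmul, LinearEquiv.apply_symm_apply, mapRight_tmul, hτ]

theorem tensorCoact_mapLeft (τ : N →ₗ[k] BalTensor k S N D.carrier)
    (hR : ∀ (r : R) (n : N), τ (r • n) = r • τ n)
    (f : M →ₗ[k] M') (hf : ∀ (r : R) (m : M), f (op r • m) = op r • f m)
    (z : BalTensor k R M N) :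
    tensorCoact M' τ hR (mapLeft f hf z) =
      mapLeft (mapLeft f hf) (mapLeft_op_smul f hf) (tensorCoact M τ hR z) := by
  rw [tensorCoact, LinearMap.comp_apply, LinearEquiv.coe_coe, LinearEquiv.symm_apply_eq,
    assoc_mapLeft_mapLeft, tensorCoact, LinearMap.comp_apply, LinearEquiv.coe_coe,
    LinearEquiv.apply_symm_apply, mapLeft_mapRight]

theorem tensorCoact_mapRight (τ : N →ₗ[k] BalTensor k S N D.carrier)
    (hR : ∀ (r : R) (n : N), τ (r • n) = r • τ n)
    (τ' : N' →ₗ[k] BalTensor k S N' D.carrier)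
    (hR' : ∀ (r : R) (n : N'), τ' (r • n) = r • τ' n)
    (g : N →ₗ[k] N') (hg : ∀ (r : R) (n : N), g (r • n) = r • g n)
    (hS : ∀ (s : S) (n : N), g (op s • n) = op s • g n)
    (hgτ : ∀ n, τ' (g n) = mapLeft g hS (τ n))
    (z : BalTensor k R M N) :
    tensorCoact M τ' hR' (mapRight g hg z) =
      mapLeft (mapRight g hg) (mapRight_op_smul g hg hS) (tensorCoact M τ hR z) := by
  rw [tensorCoact, LinearMap.comp_apply, LinearEquiv.coe_coe, LinearEquiv.symm_apply_eq,
    assoc_mapLeft_mapRight g hg hS, tensorCoact, LinearMap.comp_apply, LinearEquiv.coe_coe,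
    LinearEquiv.apply_symm_apply]
  induction z using BalTensor.induction with
  | zero => simp
  | add y z hy hz => simp only [map_add, hy, hz]
  | tmul m n => simp [hgτ]

theorem tensorCoact_assoc {Q P : Type u} [Ring Q] [Algebra k Q]
    [AddCommGroup P] [Module k P] [Module Q P] [Module Rᵐᵒᵖ P] [IsScalarTower k Q P]
    [IsScalarTower k Rᵐᵒᵖ P] [SMulCommClass Q Rᵐᵒᵖ P] [Module Qᵐᵒᵖ M]
    (τ : N →ₗ[k] BalTensor k S N D.carrier)
    (hR : ∀ (r : R) (n : N), τ (r • n) = r • τ n)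
    (z : BalTensor k R (BalTensor k Q M P) N) :
    mapLeft assoc.toLinearMap (assoc_op_smul (k := k)) (tensorCoact (BalTensor k Q M P) τ hR z) =
      tensorCoact M (tensorCoact P τ hR) (tensorCoact_smul τ hR) (assoc z) := by
  induction z using tmul_induction_left with
  | zero => simp
  | add y z hy hz => simp only [map_add, hy, hz]
  | tmul m p n =>
    rw [tensorCoact_tmul, assoc_tmul, tensorCoact_tmul, tensorCoact_tmul]
    generalize τ n = w
    induction w using BalTensor.induction with
    | zero => simp [tmul_zero]
    | add y z hy hz => simp only [map_add, tmul_add, hy, hz]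
    | tmul n d => simp

end BalTensor

end Induced

section Functors

open BalTensor

variable {k A L : Type u} [CommRing k] [Ring A] [Algebra k A] [Ring L] [Algebra k L]
  {C : Coring k A} {D : Coring k L}

/-- The functor `- ⊗_L D ⊗_L D` on right `L`-module maps. -/
def tensorTwice (D : Coring k L) {X Y : Type u} [AddCommGroup X] [Module k X] [Module Lᵐᵒᵖ X]
    [AddCommGroup Y] [Module k Y] [Module Lᵐᵒᵖ Y] (f : X →ₗ[k] Y)
    (hf : ∀ (l : L) (x : X), f (op l • x) = op l • f x) :
    BalTensor k L (BalTensor k L X D.carrier) D.carrier →ₗ[k]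
      BalTensor k L (BalTensor k L Y D.carrier) D.carrier :=
  mapLeft (mapLeft f hf) (mapLeft_op_smul f hf)

/-- The right regular comodule. -/
def Coring.regular (D : Coring k L) : RComod D where
  carrier := D.carrier
  coact := D.comul
  coact_op_smul := D.comul_op_smul
  coassoc := D.coassoc
  counit := D.comul_counit

namespace CoringExtension

variable [Module Lᵐᵒᵖ C.carrier] [IsScalarTower k Lᵐᵒᵖ C.carrier] [SMulCommClass A Lᵐᵒᵖ C.carrier]
  (E : CoringExtension C D)

/-- `C` as a right `D`-comodule. -/
def comodC : RComod D where
  carrier := C.carrier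
  coact := E.coact
  coact_op_smul := E.coact_op_smul
  coassoc := E.coassoc
  counit := E.counit

/-- The right `L`-action `m l = m⁰ ε(m¹ l)` on a right `C`-comodule. -/
def act (_E : CoringExtension C D) (M : RComod C) (l : L) : M.carrier →ₗ[k] M.carrier :=
  (contractRight (C.counit.comp (Module.toModuleEnd k (S := Lᵐᵒᵖ) C.carrier (op l)))
    (fun a c => by simp [← smul_comm a (op l) c, C.counit_smul])).comp M.coact

theorem coact_act (M : RComod C) (l : L) (m : M.carrier) :
    M.coact (E.act M l m) = op l • M.coact m := by
  rw [act, LinearMap.comp_apply, ← contractRight_mapLeft _ _ M.coact M.coact_op_smul,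
    contractRight_assoc, M.coassoc]
  generalize M.coact m = x
  induction x using BalTensor.induction with
  | zero => simp
  | add y z hy hz => simp only [map_add, smul_add, hy, hz]
  | tmul m c =>
    rw [mapRight_tmul, mapRight_tmul, right_smul_tmul]
    congr 1
    rw [contractRight_comp C.counit C.counit_smul _
      (fun a c => by simp [smul_comm a (op l) c])]
    change contractRight C.counit C.counit_smul (op l • C.comul c) = _
    rw [← E.comul_op_smul, C.comul_counit]

theorem coact_injective (M : RComod C) : Function.Injective M.coact :=
  Function.LeftInverse.injective M.counit

/-- The comodule `M`, considered with its right `L`-module structure. -/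
def Res (_E : CoringExtension C D) (M : RComod C) : Type u := M.carrier

instance (M : RComod C) : AddCommGroup (E.Res M) := inferInstanceAs (AddCommGroup M.carrier)

instance (M : RComod C) : Module k (E.Res M) := inferInstanceAs (Module k M.carrier)

/-- The `C`-coaction as a map on `E.Res M`. -/
def rho (M : RComod C) : E.Res M →ₗ[k] BalTensor k A M.carrier C.carrier := M.coact

theorem rho_injective (M : RComod C) : Function.Injective (E.rho M) := coact_injective M

instance (M : RComod C) : SMul Lᵐᵒᵖ (E.Res M) := ⟨fun l m => E.act M (unop l) m⟩

theorem rho_op_smul (M : RComod C) (l : L) (m : E.Res M) :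
    E.rho M (op l • m) = op l • E.rho M m :=
  E.coact_act M l m

instance (M : RComod C) : Module Lᵐᵒᵖ (E.Res M) :=
  Function.Injective.module Lᵐᵒᵖ (E.rho M).toAddMonoidHom (E.rho_injective M)
    (fun l m => E.rho_op_smul M (unop l) m)

instance (M : RComod C) : IsScalarTower k Lᵐᵒᵖ (E.Res M) where
  smul_assoc c l m := E.rho_injective M <| by
    induction l using MulOpposite.rec' with | _ l
    rw [← op_smul, rho_op_smul, (E.rho M).map_smul, rho_op_smul, op_smul, smul_assoc]

/-- The map `ρ ⊗_A C : M ⊗_A C → M ⊗_A C ⊗_A C`. -/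
def rhoC (_E : CoringExtension C D) (M : RComod C) : BalTensor k A M.carrier C.carrier →ₗ[k]
    BalTensor k A M.carrier (BalTensor k A C.carrier C.carrier) :=
  assoc.toLinearMap.comp (mapLeft M.coact M.coact_op_smul)

/-- The map `M ⊗_A Δ : M ⊗_A C → M ⊗_A C ⊗_A C`. -/
def comulC (_E : CoringExtension C D) (M : RComod C) : BalTensor k A M.carrier C.carrier →ₗ[k]
    BalTensor k A M.carrier (BalTensor k A C.carrier C.carrier) :=
  mapRight C.comul C.comul_smul

theorem rhoC_op_smul (M : RComod C) (l : L) (x : BalTensor k A M.carrier C.carrier) :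
    E.rhoC M (op l • x) = op l • E.rhoC M x := by
  simp only [rhoC, LinearMap.comp_apply, LinearEquiv.coe_coe]
  rw [mapLeft_op_smul, assoc_op_smul]

theorem comulC_op_smul (M : RComod C) (l : L) (x : BalTensor k A M.carrier C.carrier) :
    E.comulC M (op l • x) = op l • E.comulC M x :=
  mapRight_op_smul _ _ E.comul_op_smul l x

/-- Purity: for every right `C`-comodule `M`, the equalizer
`M → M ⊗_A C ⇉ M ⊗_A C ⊗_A C` of right `L`-modules is preserved by `- ⊗_L D ⊗_L D`. -/
def IsPure : Prop :=
  ∀ M : RComod C,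
    Function.Injective (tensorTwice D (E.rho M) (E.rho_op_smul M)) ∧
    ∀ y, tensorTwice D (E.rhoC M) (E.rhoC_op_smul M) y =
        tensorTwice D (E.comulC M) (E.comulC_op_smul M) y →
      ∃ x, tensorTwice D (E.rho M) (E.rho_op_smul M) x = y

/-- `ρ ⊗_L D`. -/
def rhoD (M : RComod C) : BalTensor k L (E.Res M) D.carrier →ₗ[k]
    BalTensor k L (BalTensor k A M.carrier C.carrier) D.carrier :=
  mapLeft (E.rho M) (E.rho_op_smul M)

/-- The coaction `m ⊗ c ↦ (m ⊗ c₀) ⊗ c₁` on `M ⊗_A C`. -/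
def coactC (M : RComod C) : BalTensor k A M.carrier C.carrier →ₗ[k]
    BalTensor k L (BalTensor k A M.carrier C.carrier) D.carrier :=
  tensorCoact M.carrier E.coact E.coact_smul

theorem coactC_op_smul (M : RComod C) (l : L) (x : BalTensor k A M.carrier C.carrier) :
    E.coactC M (op l • x) = op l • E.coactC M x :=
  tensorCoact_op_smul _ _ E.coact_op_smul l x

/-- A comodule map, considered as a map of right `L`-modules. -/
def resMap {M N : RComod C} (f : M ⟶ N) : E.Res M →ₗ[k] E.Res N := RComod.Hom.lin f

theorem rho_resMap {M N : RComod C} (f : M ⟶ N) (m : E.Res M) :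
    E.rho N (E.resMap f m) = mapLeft (RComod.Hom.lin f) (RComod.Hom.lin_op_smul f) (E.rho M m) :=
  RComod.Hom.coact_lin f m

theorem resMap_op_smul {M N : RComod C} (f : M ⟶ N) (l : L) (m : E.Res M) :
    E.resMap f (op l • m) = op l • E.resMap f m :=
  E.rho_injective N <| by
    rw [rho_op_smul, rho_resMap, rho_resMap, rho_op_smul, mapLeft_op_smul]

variable {E}

theorem IsPure.rhoD_injective (hE : E.IsPure) (M : RComod C) : Function.Injective (E.rhoD M) := by
  intro x y hxy
  have h := (hE M).1 (a₁ := tensorCoact _ D.comul D.comul_smul x)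
    (a₂ := tensorCoact _ D.comul D.comul_smul y) (by
      unfold tensorTwice
      rw [← tensorCoact_mapLeft, ← tensorCoact_mapLeft]
      exact congrArg _ hxy)
  have := congrArg (contractRight D.counit D.counit_smul) h
  rwa [tensorCoact_counit _ _ D.comul_counit, tensorCoact_counit _ _ D.comul_counit] at this

theorem IsPure.exists_rhoD (hE : E.IsPure) (M : RComod C) (m : E.Res M) :
    ∃ t, E.rhoD M t = E.coactC M (E.rho M m) := by
  have key : mapLeft (E.rhoC M) (E.rhoC_op_smul M) (E.coactC M (E.rho M m)) =
      mapLeft (E.comulC M) (E.comulC_op_smul M) (E.coactC M (E.rho M m)) := by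
    have h1 : mapLeft (E.rhoC M) (E.rhoC_op_smul M) (E.coactC M (E.rho M m)) =
        tensorCoact M.carrier (tensorCoact C.carrier E.coact E.coact_smul)
          (tensorCoact_smul E.coact E.coact_smul) (E.rhoC M (E.rho M m)) := by
      refine Eq.symm ((tensorCoact_assoc E.coact E.coact_smul
        (mapLeft M.coact M.coact_op_smul (E.rho M m))).symm.trans ?_)
      exact (congrArg _ (tensorCoact_mapLeft E.coact E.coact_smul M.coact M.coact_op_smul
        (E.rho M m))).trans (mapLeft_mapLeft _ _ _ _ _)
    have h2 : mapLeft (E.comulC M) (E.comulC_op_smul M) (E.coactC M (E.rho M m)) =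
        tensorCoact M.carrier (tensorCoact C.carrier E.coact E.coact_smul)
          (tensorCoact_smul E.coact E.coact_smul) (E.comulC M (E.rho M m)) := by
      refine (tensorCoact_mapRight E.coact E.coact_smul _ _ C.comul C.comul_smul
        E.comul_op_smul (fun c => ?_) (E.rho M m)).symm
      rw [tensorCoact, LinearMap.comp_apply, LinearEquiv.coe_coe, LinearEquiv.symm_apply_eq]
      exact (E.compat c).symm
    rw [h1, h2]
    exact congrArg _ (M.coassoc m)
  obtain ⟨x, hx⟩ := (hE M).2 (tensorCoact _ D.comul D.comul_smul (E.coactC M (E.rho M m))) (by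
    unfold tensorTwice
    rw [← tensorCoact_mapLeft, ← tensorCoact_mapLeft, key])
  refine ⟨contractRight D.counit D.counit_smul x, ?_⟩
  have := congrArg (contractRight D.counit D.counit_smul) hx
  rw [tensorCoact_counit _ _ D.comul_counit] at this
  rw [← this]
  unfold tensorTwice
  rw [contractRight_mapLeft]
  rfl

/-- The `D`-coaction on a right `C`-comodule `M`: the element `τ_M(m)` of `M ⊗_L D` is the unique
preimage under `ρ ⊗_L D` of `m⁰ ⊗ τ(m¹)`, which is an element of `(M □_C C) ⊗_L D` by purity. -/
def IsPure.tau (hE : E.IsPure) (M : RComod C) :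
    E.Res M →ₗ[k] BalTensor k L (E.Res M) D.carrier where
  toFun m := (hE.exists_rhoD M m).choose
  map_add' m n :=
    have h := fun m => (hE.exists_rhoD M m).choose_spec
    hE.rhoD_injective M <| (h (m + n)).trans <|
      ((congrArg _ (map_add _ m n)).trans (map_add _ _ _)).trans
        ((map_add _ _ _).trans (congrArg₂ _ (h m) (h n))).symm
  map_smul' c m :=
    have h := fun m => (hE.exists_rhoD M m).choose_spec
    hE.rhoD_injective M <| (h (c • m)).trans <|
      ((congrArg _ (map_smul _ c m)).trans (map_smul _ _ _)).trans
        ((map_smul _ _ _).trans (congrArg _ (h m))).symm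

theorem IsPure.rhoD_tau (hE : E.IsPure) (M : RComod C) (m : E.Res M) :
    E.rhoD M (hE.tau M m) = E.coactC M (E.rho M m) :=
  (hE.exists_rhoD M m).choose_spec

theorem IsPure.tau_op_smul (hE : E.IsPure) (M : RComod C) (l : L) (m : E.Res M) :
    hE.tau M (op l • m) = op l • hE.tau M m := hE.rhoD_injective M <| by
  rw [hE.rhoD_tau, rho_op_smul, coactC, tensorCoact_op_smul _ _ E.coact_op_smul, rhoD,
    mapLeft_op_smul]
  exact congrArg _ (hE.rhoD_tau M m).symm

/-- The right `D`-comodule `U M = M □_C C ≅ M`. -/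
def IsPure.obj (hE : E.IsPure) (M : RComod C) : RComod D where
  carrier := E.Res M
  coact := hE.tau M
  coact_op_smul := hE.tau_op_smul M
  coassoc m := by
    rw [← LinearEquiv.eq_symm_apply]
    apply (hE M).1
    have h1 : tensorTwice D (E.rho M) (E.rho_op_smul M)
        (mapLeft (hE.tau M) (hE.tau_op_smul M) (hE.tau M m)) =
          mapLeft (E.coactC M) (E.coactC_op_smul M)
            (E.coactC M (E.rho M m)) := by
      rw [← hE.rhoD_tau, tensorTwice, mapLeft_mapLeft, rhoD, mapLeft_mapLeft]
      exact mapLeft_congr (LinearMap.ext (hE.rhoD_tau M)) _ _ _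
    have h2 : tensorTwice D (E.rho M) (E.rho_op_smul M)
        (assoc.symm (mapRight D.comul D.comul_smul (hE.tau M m))) =
          assoc.symm (mapRight D.comul D.comul_smul (E.coactC M (E.rho M m))) := by
      rw [← hE.rhoD_tau]
      exact (tensorCoact_mapLeft D.comul D.comul_smul _ (E.rho_op_smul M) _).symm
    rw [h1, h2, LinearEquiv.eq_symm_apply]
    exact tensorCoact_coassoc E.coact E.coact_smul E.coact_op_smul E.coassoc _
  counit m := E.rho_injective M <| by
    rw [← contractRight_mapLeft _ _ (E.rho M) (E.rho_op_smul M)]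
    refine (congrArg _ (hE.rhoD_tau M m)).trans ?_
    exact tensorCoact_counit E.coact E.coact_smul E.counit _

/-- The functor `U = - □_C C : M^C → M^D`; it does not change the underlying `k`-modules and
maps. -/
def IsPure.U (hE : E.IsPure) : RComod C ⥤ RComod D where
  obj M := hE.obj M
  map {M N} f := RComod.Hom.mk (M := hE.obj M) (N := hE.obj N) (E.resMap f) (E.resMap_op_smul f)
    fun m => hE.rhoD_injective N <| by
      refine (hE.rhoD_tau N _).trans ?_
      refine (congrArg _ (E.rho_resMap f m)).trans ?_
      refine (tensorCoact_mapLeft E.coact E.coact_smul _ _ _).trans ?_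
      refine (congrArg _ (hE.rhoD_tau M m).symm).trans ?_
      refine (mapLeft_mapLeft _ _ _ _ _).trans ?_
      refine Eq.trans ?_ (mapLeft_mapLeft _ _ _ _ _).symm
      exact mapLeft_congr (LinearMap.ext fun m => (E.rho_resMap f m).symm) _ _ _
  map_id _ := rfl
  map_comp _ _ := rfl

instance (hE : E.IsPure) : hE.U.Additive where
  map_add := rfl

instance (hE : E.IsPure) : hE.U.Linear k where
  map_smul _ _ := rfl

end CoringExtension

namespace BiComod

/-- Left multiplication by `l`, as an endomorphism of the right `C`-comodule `Σ`. -/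
def lmul (S : BiComod L C) (l : L) : S.toRComod ⟶ S.toRComod :=
  RComod.Hom.mk (Module.toModuleEnd k (S := L) S.carrier l) (fun a x => smul_comm l (op a) x)
    fun x => S.coact_smul l x

@[simp] theorem lin_lmul (S : BiComod L C) (l : L) (x : S.carrier) :
    RComod.Hom.lin (S.lmul l) x = l • x := (rfl)

/-- The right `L`-module structure `(φ l)(x) = φ(l x)` on `Hom^C(Σ, M)`. -/
instance (S : BiComod L C) (M : RComod C) : Module Lᵐᵒᵖ (S.toRComod ⟶ M) where
  smul l φ := S.lmul (unop l) ≫ φ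
  one_smul φ := RComod.hom_ext fun x => congrArg (RComod.Hom.lin φ) (one_smul L x)
  mul_smul l l' φ := RComod.hom_ext fun x =>
    congrArg (RComod.Hom.lin φ) (mul_smul (unop l') (unop l) x)
  smul_zero _ := Limits.comp_zero
  smul_add _ _ _ := Preadditive.comp_add _ _ _ _ _ _
  add_smul l l' φ := RComod.hom_ext fun x =>
    (congrArg (RComod.Hom.lin φ) (add_smul (unop l) (unop l') x)).trans (map_add _ _ _)
  zero_smul φ := RComod.hom_ext fun x =>
    (congrArg (RComod.Hom.lin φ) (zero_smul L x)).trans (map_zero _)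

theorem op_smul_def (S : BiComod L C) {M : RComod C} (l : L) (φ : S.toRComod ⟶ M) :
    op l • φ = S.lmul l ≫ φ := (rfl)

instance (S : BiComod L C) (M : RComod C) : IsScalarTower k Lᵐᵒᵖ (S.toRComod ⟶ M) where
  smul_assoc c l φ := RComod.hom_ext fun x =>
    (congrArg (RComod.Hom.lin φ) (smul_assoc c (unop l) x)).trans (map_smul _ _ _)

/-- The right `D`-comodule `Hom^C(Σ, M) ⊗_L D`. -/
def VObj (S : BiComod L C) (D : Coring k L) (M : RComod C) : RComod D where
  carrier := BalTensor k L (S.toRComod ⟶ M) D.carrier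
  coact := tensorCoact (S.toRComod ⟶ M) D.comul D.comul_smul
  coact_op_smul := tensorCoact_op_smul _ _ D.comul_op_smul
  coassoc := tensorCoact_coassoc _ _ D.comul_op_smul D.coassoc
  counit := tensorCoact_counit _ _ D.comul_counit

/-- Composition with a comodule map `f : M → N`, as a map `Hom^C(Σ, M) → Hom^C(Σ, N)`. -/
def postcomp (S : BiComod L C) {M N : RComod C} (f : M ⟶ N) :
    (S.toRComod ⟶ M) →ₗ[k] (S.toRComod ⟶ N) :=
  Linear.rightComp k S.toRComod f

theorem postcomp_op_smul (S : BiComod L C) {M N : RComod C} (f : M ⟶ N) (l : L)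
    (φ : S.toRComod ⟶ M) : S.postcomp f (op l • φ) = op l • S.postcomp f φ :=
  Category.assoc (S.lmul l) φ f

/-- The functor `V = Hom^C(Σ, -) ⊗_L D : M^C → M^D`. -/
def V (S : BiComod L C) (D : Coring k L) : RComod C ⥤ RComod D where
  obj M := S.VObj D M
  map {M N} f := RComod.Hom.mk (M := S.VObj D M) (N := S.VObj D N)
    (mapLeft (S.postcomp f) (S.postcomp_op_smul f))
    (mapLeft_op_smul (S.postcomp f) (S.postcomp_op_smul f))
    (fun z => tensorCoact_mapLeft D.comul D.comul_smul (S.postcomp f) (S.postcomp_op_smul f) z)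
  map_id _ := RComod.hom_ext fun z => mapLeft_id (fun _ _ => rfl) z
  map_comp f g := RComod.hom_ext fun z =>
    (mapLeft_mapLeft (S.postcomp f) (S.postcomp_op_smul f) (S.postcomp g)
      (S.postcomp_op_smul g) z).symm

instance (S : BiComod L C) (D : Coring k L) : (S.V D).Additive where
  map_add {_ _ f g} := Subtype.ext <| BalTensor.hom_ext fun φ d => by
    change tmul k L (φ ≫ (f + g)) d = tmul k L (φ ≫ f) d + tmul k L (φ ≫ g) d
    rw [Preadditive.comp_add, add_tmul]

instance (S : BiComod L C) (D : Coring k L) : (S.V D).Linear k where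
  map_smul f r := Subtype.ext <| BalTensor.hom_ext fun φ d => by
    change tmul k L (φ ≫ (r • f)) d = r • tmul k L (φ ≫ f) d
    rw [Linear.comp_smul, base_smul_tmul]

end BiComod

end Functors

/-! ### Morita contexts -/

section Morita

universe u₀ u₁ u₂ u₃ u₄ v₁ v₂ v₃ v₄

/-- A Morita context over `k` on the `k`-modules `R`, `S`, `P`, `Q`: algebra structures on `R` and
`S`, an `R`-`S` bimodule structure on `P`, an `S`-`R` bimodule structure on `Q`, and connecting
maps `Q ⊗_R P → S` and `P ⊗_S Q → R`, given as balanced bilinear maps, that are bimodule maps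
and satisfy the two associativity conditions. -/
structure MoritaContext (k : Type u₀) [CommRing k]
    (R : Type u₁) (S : Type u₂) (P : Type u₃) (Q : Type u₄)
    [AddCommGroup R] [Module k R] [AddCommGroup S] [Module k S]
    [AddCommGroup P] [Module k P] [AddCommGroup Q] [Module k Q] where
  mulR : R →ₗ[k] R →ₗ[k] R
  oneR : R
  mulR_assoc : ∀ r r' r'', mulR (mulR r r') r'' = mulR r (mulR r' r'')
  oneR_mul : ∀ r, mulR oneR r = r
  mulR_one : ∀ r, mulR r oneR = r
  mulS : S →ₗ[k] S →ₗ[k] S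
  oneS : S
  mulS_assoc : ∀ s s' s'', mulS (mulS s s') s'' = mulS s (mulS s' s'')
  oneS_mul : ∀ s, mulS oneS s = s
  mulS_one : ∀ s, mulS s oneS = s
  actRP : R →ₗ[k] P →ₗ[k] P
  mulR_actRP : ∀ r r' p, actRP (mulR r r') p = actRP r (actRP r' p)
  oneR_actRP : ∀ p, actRP oneR p = p
  actPS : P →ₗ[k] S →ₗ[k] P
  actPS_mulS : ∀ p s s', actPS p (mulS s s') = actPS (actPS p s) s'
  actPS_oneS : ∀ p, actPS p oneS = p
  actRP_actPS : ∀ r p s, actPS (actRP r p) s = actRP r (actPS p s)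
  actSQ : S →ₗ[k] Q →ₗ[k] Q
  mulS_actSQ : ∀ s s' q, actSQ (mulS s s') q = actSQ s (actSQ s' q)
  oneS_actSQ : ∀ q, actSQ oneS q = q
  actQR : Q →ₗ[k] R →ₗ[k] Q
  actQR_mulR : ∀ q r r', actQR q (mulR r r') = actQR (actQR q r) r'
  actQR_oneR : ∀ q, actQR q oneR = q
  actSQ_actQR : ∀ s q r, actQR (actSQ s q) r = actSQ s (actQR q r)
  pairQP : Q →ₗ[k] P →ₗ[k] S
  pairQP_balanced : ∀ q r p, pairQP (actQR q r) p = pairQP q (actRP r p)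
  pairQP_left : ∀ s q p, pairQP (actSQ s q) p = mulS s (pairQP q p)
  pairQP_right : ∀ q p s, pairQP q (actPS p s) = mulS (pairQP q p) s
  pairPQ : P →ₗ[k] Q →ₗ[k] R
  pairPQ_balanced : ∀ p s q, pairPQ (actPS p s) q = pairPQ p (actSQ s q)
  pairPQ_left : ∀ r p q, pairPQ (actRP r p) q = mulR r (pairPQ p q)
  pairPQ_right : ∀ p q r, pairPQ p (actQR q r) = mulR (pairPQ p q) r
  assocQPQ : ∀ q p q', actSQ (pairQP q p) q' = actQR q (pairPQ p q')
  assocPQP : ∀ p q p', actRP (pairPQ p q) p' = actPS p (pairQP q p')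

/-- An isomorphism of Morita contexts: four `k`-linear isomorphisms that are compatible with all
structure maps. -/
structure MoritaContext.Iso {k : Type u₀} [CommRing k]
    {R : Type u₁} {S : Type u₂} {P : Type u₃} {Q : Type u₄}
    [AddCommGroup R] [Module k R] [AddCommGroup S] [Module k S]
    [AddCommGroup P] [Module k P] [AddCommGroup Q] [Module k Q]
    {R' : Type v₁} {S' : Type v₂} {P' : Type v₃} {Q' : Type v₄}
    [AddCommGroup R'] [Module k R'] [AddCommGroup S'] [Module k S']
    [AddCommGroup P'] [Module k P'] [AddCommGroup Q'] [Module k Q']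
    (X : MoritaContext k R S P Q) (Y : MoritaContext k R' S' P' Q') where
  α₁ : R ≃ₗ[k] R'
  α₂ : S ≃ₗ[k] S'
  α₃ : P ≃ₗ[k] P'
  α₄ : Q ≃ₗ[k] Q'
  map_oneR : α₁ X.oneR = Y.oneR
  map_mulR : ∀ r r', α₁ (X.mulR r r') = Y.mulR (α₁ r) (α₁ r')
  map_oneS : α₂ X.oneS = Y.oneS
  map_mulS : ∀ s s', α₂ (X.mulS s s') = Y.mulS (α₂ s) (α₂ s')
  map_actRP : ∀ r p, α₃ (X.actRP r p) = Y.actRP (α₁ r) (α₃ p)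
  map_actPS : ∀ p s, α₃ (X.actPS p s) = Y.actPS (α₃ p) (α₂ s)
  map_actSQ : ∀ s q, α₄ (X.actSQ s q) = Y.actSQ (α₂ s) (α₄ q)
  map_actQR : ∀ q r, α₄ (X.actQR q r) = Y.actQR (α₄ q) (α₁ r)
  map_pairQP : ∀ q p, α₂ (X.pairQP q p) = Y.pairQP (α₄ q) (α₃ p)
  map_pairPQ : ∀ p q, α₁ (X.pairPQ p q) = Y.pairPQ (α₃ p) (α₄ q)

/-- The Morita context `(End(X)^op, End(Y)^op, Hom(X, Y), Hom(Y, X))` determined by two objects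
of a `k`-linear category; all products are opposite compositions, `f g = g ∘ f = f ≫ g`. -/
def MoritaContext.ofObjects (k : Type u₀) [CommRing k] {𝒞 : Type u₁} [Category.{u₂} 𝒞]
    [Preadditive 𝒞] [Linear k 𝒞] (X Y : 𝒞) :
    MoritaContext k (X ⟶ X) (Y ⟶ Y) (X ⟶ Y) (Y ⟶ X) where
  mulR := Linear.comp X X X
  oneR := 𝟙 X
  mulR_assoc := Category.assoc
  oneR_mul := Category.id_comp
  mulR_one := Category.comp_id
  mulS := Linear.comp Y Y Y
  oneS := 𝟙 Y
  mulS_assoc := Category.assoc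
  oneS_mul := Category.id_comp
  mulS_one := Category.comp_id
  actRP := Linear.comp X X Y
  mulR_actRP := Category.assoc
  oneR_actRP := Category.id_comp
  actPS := Linear.comp X Y Y
  actPS_mulS _ _ _ := (Category.assoc _ _ _).symm
  actPS_oneS := Category.comp_id
  actRP_actPS := Category.assoc
  actSQ := Linear.comp Y Y X
  mulS_actSQ := Category.assoc
  oneS_actSQ := Category.id_comp
  actQR := Linear.comp Y X X
  actQR_mulR _ _ _ := (Category.assoc _ _ _).symm
  actQR_oneR := Category.comp_id
  actSQ_actQR := Category.assoc
  pairQP := Linear.comp Y X Y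
  pairQP_balanced := Category.assoc
  pairQP_left := Category.assoc
  pairQP_right _ _ _ := (Category.assoc _ _ _).symm
  pairPQ := Linear.comp X Y X
  pairPQ_balanced := Category.assoc
  pairPQ_left := Category.assoc
  pairPQ_right _ _ _ := (Category.assoc _ _ _).symm
  assocQPQ := Category.assoc
  assocPQP := Category.assoc

end Morita

/-! ### The explicit context -/

section Explicit

open BalTensor

variable {k A L : Type u} [CommRing k] [Ring A] [Algebra k A] [Ring L] [Algebra k L]
  {C : Coring k A} {D : Coring k L}
  [Module Lᵐᵒᵖ C.carrier] [IsScalarTower k Lᵐᵒᵖ C.carrier] [SMulCommClass A Lᵐᵒᵖ C.carrier]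

/-- The `L`-bimodule maps `_L Hom_L(D, T)`, where `T = End^C(Σ)` has the `L`-bimodule structure
`(l t)(x) = l t(x)`, `(t l)(x) = t(l x)`. -/
def LHomL (D : Coring k L) (S : BiComod L C) :
    Submodule k (D.carrier →ₗ[k] (S.toRComod ⟶ S.toRComod)) where
  carrier := {v | (∀ (l : L) (d : D.carrier), v (l • d) = v d ≫ S.lmul l) ∧
    ∀ (l : L) (d : D.carrier), v (op l • d) = S.lmul l ≫ v d}
  zero_mem' := ⟨fun _ _ => by simp, fun _ _ => by simp⟩
  add_mem' {v w} hv hw := ⟨fun l d => by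
      rw [LinearMap.add_apply, LinearMap.add_apply, hv.1, hw.1, Preadditive.add_comp],
    fun l d => by
      rw [LinearMap.add_apply, LinearMap.add_apply, hv.2, hw.2, Preadditive.comp_add]⟩
  smul_mem' c v hv := ⟨fun l d => by
      rw [LinearMap.smul_apply, LinearMap.smul_apply, hv.1, Linear.smul_comp],
    fun l d => by
      rw [LinearMap.smul_apply, LinearMap.smul_apply, hv.2, Linear.comp_smul]⟩

/-- The map `C → C` underlying an endomorphism of the right `D`-comodule `C`. -/
def endLin (E : CoringExtension C D) : (E.comodC ⟶ E.comodC) →ₗ[k] C.carrier →ₗ[k] C.carrier :=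
  (RComod.homs E.comodC E.comodC).subtype

/-- The endomorphisms `^C End^D(C)` of the `C`-`D` bicomodule `C`. -/
def EndCD (E : CoringExtension C D) : Submodule k (E.comodC ⟶ E.comodC) where
  carrier := {u | ∃ hu : ∀ (a : A) (c : C.carrier), endLin E u (a • c) = a • endLin E u c,
    ∀ c : C.carrier, C.comul (endLin E u c) = mapRight (endLin E u) hu (C.comul c)}
  zero_mem' := ⟨fun a c => by simp, fun c => by
    generalize C.comul c = x
    induction x using BalTensor.induction with
    | zero => simp
    | tmul m c => simp [tmul_zero]
    | add y z hy hz => rw [map_add, ← hy, ← hz]; simp⟩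
  add_mem' := by
    rintro f g ⟨hf, hf'⟩ ⟨hg, hg'⟩
    refine ⟨fun a m => by simp [hf, hg], fun m => ?_⟩
    trans mapRight (endLin E f) hf (C.comul m) + mapRight (endLin E g) hg (C.comul m)
    · rw [← hf', ← hg', ← map_add]; rfl
    generalize C.comul m = x
    induction x using BalTensor.induction with
    | zero => simp
    | tmul m c => simp [tmul_add]
    | add y z hy hz => rw [map_add, map_add, map_add, ← hy, ← hz, add_add_add_comm]
  smul_mem' := by
    rintro r f ⟨hf, hf'⟩
    refine ⟨fun a m => by
      rw [(endLin E).map_smul, LinearMap.smul_apply, LinearMap.smul_apply, hf, smul_comm],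
      fun m => ?_⟩
    trans r • mapRight (endLin E f) hf (C.comul m)
    · rw [← hf', ← C.comul.map_smul]; rfl
    generalize C.comul m = x
    induction x using BalTensor.induction with
    | zero => simp
    | tmul m c => simp [base_tmul_smul]
    | add y z hy hz => rw [map_add, map_add, smul_add, hy, hz]

/-- The map `D → Σ` underlying a morphism of right `D`-comodules. -/
def colin {E : CoringExtension C D} (hE : E.IsPure) (S : BiComod L C) :
    (D.regular ⟶ hE.U.obj S.toRComod) →ₗ[k] D.carrier →ₗ[k] S.carrier :=
  (RComod.homs D.regular (hE.U.obj S.toRComod)).subtype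

/-- The left `L`-linear right `D`-colinear maps `_L Hom^D(D, Σ)`. -/
def LHomD {E : CoringExtension C D} (hE : E.IsPure) (S : BiComod L C) :
    Submodule k (D.regular ⟶ hE.U.obj S.toRComod) where
  carrier := {p | ∀ (l : L) (d : D.carrier), colin hE S p (l • d) = l • colin hE S p d}
  zero_mem' := fun l d => by simp
  add_mem' {p p'} hp hp' := fun l d => by
    rw [map_add, LinearMap.add_apply, LinearMap.add_apply, hp, hp', smul_add]
  smul_mem' c p hp := fun l d => by
    rw [(colin hE S).map_smul, LinearMap.smul_apply, LinearMap.smul_apply, hp, smul_comm]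

/-- The dual `Σ^* = Hom_A(Σ, A)`. -/
def Dual (S : BiComod L C) : Type u := S.carrier →ₗ[Aᵐᵒᵖ] A

instance (S : BiComod L C) : AddCommGroup (Dual S) :=
  inferInstanceAs (AddCommGroup (S.carrier →ₗ[Aᵐᵒᵖ] A))

instance (S : BiComod L C) : Module k (Dual S) :=
  inferInstanceAs (Module k (S.carrier →ₗ[Aᵐᵒᵖ] A))

/-- The underlying `k`-linear map of an element of `Σ^*`. -/
def dualLin (S : BiComod L C) : Dual S →ₗ[k] S.carrier →ₗ[k] A where
  toFun ξ := LinearMap.restrictScalars k (show S.carrier →ₗ[Aᵐᵒᵖ] A from ξ)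
  map_add' _ _ := rfl
  map_smul' _ _ := rfl

theorem dualLin_op_smul (S : BiComod L C) (ξ : Dual S) (a : A) (x : S.carrier) :
    dualLin S ξ (op a • x) = dualLin S ξ x * a :=
  LinearMap.map_smul (show S.carrier →ₗ[Aᵐᵒᵖ] A from ξ) (op a) x

/-- `c ↦ q(c)(x)`. -/
def evalAt {S : BiComod L C} (q : C.carrier →ₗ[k] Dual S) (x : S.carrier) : C.carrier →ₗ[k] A :=
  ((dualLin S).flip x).comp q

@[simp] theorem evalAt_apply {S : BiComod L C} (q : C.carrier →ₗ[k] Dual S) (x : S.carrier)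
    (c : C.carrier) : evalAt q x c = dualLin S (q c) x := (rfl)

/-- The `A`-`L` bimodule maps `q : C → Σ^* = Hom_A(Σ, A)` such that
`c⁽¹⁾ q(c⁽²⁾)(x) = q(c)(x⁽⁰⁾) x⁽¹⁾`, where `(a ξ l)(x) = a ξ(l x)`. -/
def Qtilde (S : BiComod L C) : Submodule k (C.carrier →ₗ[k] Dual S) where
  carrier := {q | ∃ hA : ∀ (x : S.carrier) (a : A) (c : C.carrier),
      evalAt q x (a • c) = a * evalAt q x c,
    (∀ (l : L) (c : C.carrier) (x : S.carrier), dualLin S (q (op l • c)) x = dualLin S (q c) (l • x)) ∧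
    ∀ (x : S.carrier) (c : C.carrier), contractRight (evalAt q x) (hA x) (C.comul c) =
      contractLeft (dualLin S (q c)) (dualLin_op_smul S (q c)) (S.coact x)}
  zero_mem' := by
    refine ⟨fun x a c => by simp, fun l c x => by simp, fun x c => ?_⟩
    trans 0
    · generalize C.comul c = y
      induction y using BalTensor.induction with
      | zero => simp
      | tmul m n => simp
      | add y z hy hz => rw [map_add, hy, hz, add_zero]
    · generalize S.coact x = y
      induction y using BalTensor.induction with
      | zero => simp
      | tmul m n => simp
      | add y z hy hz => rw [map_add, ← hy, ← hz, add_zero]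
  add_mem' := by
    rintro q q' ⟨hA, hL, hq⟩ ⟨hA', hL', hq'⟩
    refine ⟨fun x a c => ?_, fun l c x => by simp [hL, hL'], fun x c => ?_⟩
    · have h1 := hA x a c
      have h2 := hA' x a c
      simp only [evalAt_apply, LinearMap.add_apply, map_add] at h1 h2 ⊢
      rw [h1, h2, mul_add]
    · trans contractRight (evalAt q x) (hA x) (C.comul c) +
        contractRight (evalAt q' x) (hA' x) (C.comul c)
      · generalize C.comul c = y
        induction y using BalTensor.induction with
        | zero => simp
        | tmul m n => simp [add_smul]
        | add y z hy hz => rw [map_add, hy, hz, map_add, map_add, add_add_add_comm]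
      · rw [hq, hq']
        generalize S.coact x = y
        induction y using BalTensor.induction with
        | zero => simp
        | tmul m n => simp [add_smul]
        | add y z hy hz => rw [map_add, map_add, map_add, ← hy, ← hz, add_add_add_comm]
  smul_mem' := by
    rintro r q ⟨hA, hL, hq⟩
    refine ⟨fun x a c => ?_, fun l c x => by simp [hL], fun x c => ?_⟩
    · have h1 := hA x a c
      simp only [evalAt_apply, LinearMap.smul_apply, map_smul] at h1 ⊢
      rw [h1, mul_smul_comm]
    · trans r • contractRight (evalAt q x) (hA x) (C.comul c)
      · generalize C.comul c = y
        induction y using BalTensor.induction with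
        | zero => simp
        | tmul m n => simp
        | add y z hy hz => rw [map_add, hy, hz, map_add, smul_add]
      · rw [hq]
        generalize S.coact x = y
        induction y using BalTensor.induction with
        | zero => simp
        | tmul m n => simp
        | add y z hy hz => rw [map_add, map_add, smul_add, ← hy, ← hz]

/-- `d ↦ v(d₁) v'(d₂)`, the product taken in `T = End^C(Σ)`, that is, `v(d₁) ∘ v'(d₂)`. -/
def formulaVV {S : BiComod L C} (v v' : LHomL D S) (d : D.carrier) : S.toRComod ⟶ S.toRComod :=
  lift (LinearMap.mk₂ k (fun d d' => v'.1 d' ≫ v.1 d)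
      (fun _ _ _ => by rw [map_add, Preadditive.comp_add])
      (fun _ _ _ => by rw [map_smul, Linear.comp_smul])
      (fun _ _ _ => by rw [map_add, Preadditive.add_comp])
      (fun _ _ _ => by rw [map_smul, Linear.smul_comp]))
    (fun d l d' => by
      obtain ⟨-, hv⟩ := v.2
      obtain ⟨hv', -⟩ := v'.2
      simp only [LinearMap.mk₂_apply]
      rw [hv, hv', Category.assoc]) (D.comul d)

/-- `d ↦ v(d₁)(p(d₂))`. -/
def formulaVP {E : CoringExtension C D} {hE : E.IsPure} {S : BiComod L C} (v : LHomL D S)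
    (p : LHomD hE S) (d : D.carrier) : S.carrier :=
  lift (LinearMap.mk₂ k (fun d d' => RComod.Hom.lin (v.1 d) (colin hE S p.1 d'))
      (fun _ _ _ => by rw [map_add, RComod.Hom.lin_add, LinearMap.add_apply])
      (fun _ _ _ => by rw [map_smul, RComod.Hom.lin_smul, LinearMap.smul_apply])
      (fun _ _ _ => by rw [map_add, map_add])
      (fun _ _ _ => by rw [map_smul, map_smul]))
    (fun d l d' => by
      obtain ⟨-, hv⟩ := v.2
      simp only [LinearMap.mk₂_apply]
      rw [hv, p.2, RComod.Hom.lin_comp, BiComod.lin_lmul]) (D.comul d)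

/-- `d ↦ p(d)⁽⁰⁾ ε(u(p(d)⁽¹⁾))`. -/
def formulaPU {E : CoringExtension C D} {hE : E.IsPure} {S : BiComod L C} (p : LHomD hE S)
    (u : EndCD E) (d : D.carrier) : S.carrier :=
  contractRight (C.counit.comp (endLin E u.1))
    (fun a c => by
      obtain ⟨hu, -⟩ := u.2
      rw [LinearMap.comp_apply, hu, C.counit_smul, LinearMap.comp_apply])
    (S.coact (colin hE S p.1 d))

/-- `c ↦ (x ↦ q(c₀)(v(c₁)(x)))`. -/
def formulaQV (E : CoringExtension C D) {S : BiComod L C} (q : Qtilde S) (v : LHomL D S)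
    (c : C.carrier) (x : S.carrier) : A :=
  lift (LinearMap.mk₂ k (fun c d => dualLin S (q.1 c) (RComod.Hom.lin (v.1 d) x))
      (fun _ _ _ => by rw [map_add, map_add, LinearMap.add_apply])
      (fun _ _ _ => by rw [map_smul, map_smul, LinearMap.smul_apply])
      (fun _ _ _ => by rw [map_add, RComod.Hom.lin_add, LinearMap.add_apply, map_add])
      (fun r c d => by
        rw [map_smul, RComod.Hom.lin_smul, LinearMap.smul_apply]
        exact (dualLin S (q.1 c)).map_smul r _))
    (fun c l d => by
      obtain ⟨-, hL, -⟩ := q.2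
      obtain ⟨hv, -⟩ := v.2
      simp only [LinearMap.mk₂_apply]
      rw [hL, hv, RComod.Hom.lin_comp, BiComod.lin_lmul]) (E.coact c)

/-- The map `C ⊗_L D → A`, `c ⊗ d ↦ q(c)(p(d))`. -/
def evalQP {E : CoringExtension C D} {hE : E.IsPure} {S : BiComod L C} (q : Qtilde S)
    (p : LHomD hE S) : BalTensor k L C.carrier D.carrier →ₗ[k] A :=
  lift (LinearMap.mk₂ k (fun c d => dualLin S (q.1 c) (colin hE S p.1 d))
      (fun _ _ _ => by rw [map_add, map_add, LinearMap.add_apply])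
      (fun _ _ _ => by rw [map_smul, map_smul, LinearMap.smul_apply])
      (fun _ _ _ => by rw [map_add, map_add])
      (fun r c d => by
        rw [map_smul]
        exact (dualLin S (q.1 c)).map_smul r _))
    (fun c l d => by
      obtain ⟨-, hL, -⟩ := q.2
      simp only [LinearMap.mk₂_apply]
      rw [hL, p.2])

/-- `c ↦ c⁽¹⁾ q(c⁽²⁾₀)(p(c⁽²⁾₁))`. -/
def formulaQP {E : CoringExtension C D} {hE : E.IsPure} {S : BiComod L C} (q : Qtilde S)
    (p : LHomD hE S) (c : C.carrier) : C.carrier :=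
  contractRight ((evalQP q p).comp E.coact)
    (fun a c => by
      obtain ⟨hA, -, -⟩ := q.2
      rw [LinearMap.comp_apply, E.coact_smul, LinearMap.comp_apply]
      generalize E.coact c = y
      induction y using BalTensor.induction with
      | zero => simp
      | tmul c d =>
        rw [left_smul_tmul]
        exact hA (colin hE S p.1 d) a c
      | add y z hy hz => rw [smul_add, map_add, map_add, hy, hz, mul_add])
    (C.comul c)

/-- `c ↦ q(c₀)(p(c₁)⁽⁰⁾) p(c₁)⁽¹⁾`. -/
def formulaQPAlt {E : CoringExtension C D} {hE : E.IsPure} {S : BiComod L C} (q : Qtilde S)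
    (p : LHomD hE S) (c : C.carrier) : C.carrier :=
  lift (LinearMap.mk₂ k (fun c d =>
        contractLeft (dualLin S (q.1 c)) (dualLin_op_smul S (q.1 c)) (S.coact (colin hE S p.1 d)))
      (fun c c' d => by
        obtain ⟨hA, -, hq⟩ := q.2
        rw [← hq, ← hq, ← hq, map_add, map_add])
      (fun r c d => by
        obtain ⟨hA, -, hq⟩ := q.2
        rw [← hq, ← hq, map_smul, map_smul])
      (fun _ _ _ => by rw [map_add, map_add, map_add])
      (fun _ _ _ => by rw [map_smul, map_smul, map_smul]))
    (fun c l d => by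
      obtain ⟨-, hL, -⟩ := q.2
      simp only [LinearMap.mk₂_apply]
      rw [p.2, S.coact_smul]
      generalize S.coact (colin hE S p.1 d) = y
      induction y using BalTensor.induction with
      | zero => simp
      | tmul x c' => simp [left_smul_tmul, hL]
      | add y z hy hz => rw [smul_add, map_add, map_add, hy, hz])
    (E.coact c)

/-- `d ↦ (x ↦ p(d)⁽⁰⁾ q(p(d)⁽¹⁾)(x))`. -/
def formulaPQ {E : CoringExtension C D} {hE : E.IsPure} {S : BiComod L C} (p : LHomD hE S)
    (q : Qtilde S) (d : D.carrier) (x : S.carrier) : S.carrier :=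
  contractRight (evalAt q.1 x) (q.2.1 x) (S.coact (colin hE S p.1 d))

end Explicit

end

end CoringMorita

open CoringMorita

/-! Two objects of any `k`-linear category give a Morita context made of their Hom modules, and all
of its axioms are the associativity and unit laws of composition. Applied to `V` and `U` in the
functor category, this is the context of natural transformations. It therefore suffices to identify
each of the four concrete modules linearly with a module of natural transformations, pull the
structure back, and compute the pulled-back operations. No Morita axiom has to be checked on the
explicit formulas, and the isomorphism of contexts is the transport itself.

The identifications rest on three facts. The comodule `N ⊗_A C` is cofree: colinear maps `X → N ⊗_A
C` correspond to right linear maps `X → N` by composition with `N ⊗ ε`. Since `V M = Hom(Σ, M) ⊗_L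
D` is cofree over `D`, a transformation into `V` is a natural family of right `L`-linear maps into
`Hom(Σ, M)`.

Transformations out of `V` obey a Yoneda argument: `φ ⊗ d` is the image of `id ⊗ d` under `V φ`, so
everything is determined by the elements `id ⊗ d` at `Σ` (`natFamilyVV_tmul`, `nat_app_tmul`). This
gives `v : D → T` and `p : D → Σ`.

For transformations out of `U` the coring itself plays the role of the representing object. The
coaction `M → M ⊗_A C` is colinear, and so is `c ↦ m ⊗ c`; hence a natural family `ζ` acts on `M ⊗_A
C` as `M ⊗ ζ_C`, and `ζ_M(m) = m⁰ ε(ζ_C(m¹))` (`coact_family`, `family_eq`). For `U → U` this yields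
the bicomodule endomorphism `ζ_C`. For `U → V`, fixing `x ∈ Σ` turns the family `θ_M : M → Hom(Σ,
M)` into a natural family of endomorphisms, and `q(c)(x) = ε(θ_C(c)(x))`. The equation defining `Q̃`
is exactly what makes `x ↦ m⁰ q(m¹)(x)` colinear (`coact_contract`).

Purity enters through the injectivity of `ρ ⊗_L D`: identities between elements of `M ⊗_L D` are
tested in `M ⊗_A C ⊗_L D`, where the induced coaction becomes the given coaction on `C`. -/

namespace CoringMorita

noncomputable section

open BalTensor

/-! ### Transport of Morita contexts along linear isomorphisms. -/

namespace MoritaContext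

universe u₀ u₁ u₂ u₃ u₄ v₁ v₂ v₃ v₄

variable {k : Type u₀} [CommRing k]
  {R : Type u₁} {S : Type u₂} {P : Type u₃} {Q : Type u₄}
  [AddCommGroup R] [Module k R] [AddCommGroup S] [Module k S]
  [AddCommGroup P] [Module k P] [AddCommGroup Q] [Module k Q]
  {R' : Type v₁} {S' : Type v₂} {P' : Type v₃} {Q' : Type v₄}
  [AddCommGroup R'] [Module k R'] [AddCommGroup S'] [Module k S']
  [AddCommGroup P'] [Module k P'] [AddCommGroup Q'] [Module k Q']

/-- The Morita context obtained from `Y` by transport of structure along linear isomorphisms. -/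
def transport (Y : MoritaContext k R' S' P' Q') (α₁ : R ≃ₗ[k] R') (α₂ : S ≃ₗ[k] S')
    (α₃ : P ≃ₗ[k] P') (α₄ : Q ≃ₗ[k] Q') : MoritaContext k R S P Q where
  mulR := (Y.mulR.compl₁₂ α₁.toLinearMap α₁.toLinearMap).compr₂ α₁.symm.toLinearMap
  oneR := α₁.symm Y.oneR
  mulR_assoc _ _ _ := by simp [Y.mulR_assoc]
  oneR_mul _ := by simp [Y.oneR_mul]
  mulR_one _ := by simp [Y.mulR_one]
  mulS := (Y.mulS.compl₁₂ α₂.toLinearMap α₂.toLinearMap).compr₂ α₂.symm.toLinearMap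
  oneS := α₂.symm Y.oneS
  mulS_assoc _ _ _ := by simp [Y.mulS_assoc]
  oneS_mul _ := by simp [Y.oneS_mul]
  mulS_one _ := by simp [Y.mulS_one]
  actRP := (Y.actRP.compl₁₂ α₁.toLinearMap α₃.toLinearMap).compr₂ α₃.symm.toLinearMap
  mulR_actRP _ _ _ := by simp [Y.mulR_actRP]
  oneR_actRP _ := by simp [Y.oneR_actRP]
  actPS := (Y.actPS.compl₁₂ α₃.toLinearMap α₂.toLinearMap).compr₂ α₃.symm.toLinearMap
  actPS_mulS _ _ _ := by simp [Y.actPS_mulS]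
  actPS_oneS _ := by simp [Y.actPS_oneS]
  actRP_actPS _ _ _ := by simp [Y.actRP_actPS]
  actSQ := (Y.actSQ.compl₁₂ α₂.toLinearMap α₄.toLinearMap).compr₂ α₄.symm.toLinearMap
  mulS_actSQ _ _ _ := by simp [Y.mulS_actSQ]
  oneS_actSQ _ := by simp [Y.oneS_actSQ]
  actQR := (Y.actQR.compl₁₂ α₄.toLinearMap α₁.toLinearMap).compr₂ α₄.symm.toLinearMap
  actQR_mulR _ _ _ := by simp [Y.actQR_mulR]
  actQR_oneR _ := by simp [Y.actQR_oneR]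
  actSQ_actQR _ _ _ := by simp [Y.actSQ_actQR]
  pairQP := (Y.pairQP.compl₁₂ α₄.toLinearMap α₃.toLinearMap).compr₂ α₂.symm.toLinearMap
  pairQP_balanced _ _ _ := by simp [Y.pairQP_balanced]
  pairQP_left _ _ _ := by simp [Y.pairQP_left]
  pairQP_right _ _ _ := by simp [Y.pairQP_right]
  pairPQ := (Y.pairPQ.compl₁₂ α₃.toLinearMap α₄.toLinearMap).compr₂ α₁.symm.toLinearMap
  pairPQ_balanced _ _ _ := by simp [Y.pairPQ_balanced]
  pairPQ_left _ _ _ := by simp [Y.pairPQ_left]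
  pairPQ_right _ _ _ := by simp [Y.pairPQ_right]
  assocQPQ _ _ _ := by simp [Y.assocQPQ]
  assocPQP _ _ _ := by simp [Y.assocPQP]

/-- The isomorphism from the transported context to the original one. -/
def transportIso (Y : MoritaContext k R' S' P' Q') (α₁ : R ≃ₗ[k] R') (α₂ : S ≃ₗ[k] S')
    (α₃ : P ≃ₗ[k] P') (α₄ : Q ≃ₗ[k] Q') : (Y.transport α₁ α₂ α₃ α₄).Iso Y where
  α₁ := α₁
  α₂ := α₂
  α₃ := α₃
  α₄ := α₄
  map_oneR := by simp [transport]
  map_mulR _ _ := by simp [transport]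
  map_oneS := by simp [transport]
  map_mulS _ _ := by simp [transport]
  map_actRP _ _ := by simp [transport]
  map_actPS _ _ := by simp [transport]
  map_actSQ _ _ := by simp [transport]
  map_actQR _ _ := by simp [transport]
  map_pairQP _ _ := by simp [transport]
  map_pairPQ _ _ := by simp [transport]

end MoritaContext

/-! ### Cofree comodules `N ⊗_A C` and their universal property. -/

section Cofree

variable {k A : Type u} [CommRing k] [Ring A] [Algebra k A] (C : Coring k A)
  {N : Type u} [AddCommGroup N] [Module k N] [Module Aᵐᵒᵖ N] [IsScalarTower k Aᵐᵒᵖ N]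

variable (N) in
/-- The right comodule `N ⊗_A C`. -/
def Coring.cofree : RComod C where
  carrier := BalTensor k A N C.carrier
  coact := tensorCoact N C.comul C.comul_smul
  coact_op_smul := tensorCoact_op_smul _ _ C.comul_op_smul
  coassoc := tensorCoact_coassoc _ _ C.comul_op_smul C.coassoc
  counit := tensorCoact_counit _ _ C.comul_counit

variable (N) in
/-- The map `N ⊗_A ε : N ⊗_A C → N`. -/
def Coring.cofreeCounit : BalTensor k A N C.carrier →ₗ[k] N :=
  contractRight C.counit C.counit_smul

@[simp] theorem Coring.cofreeCounit_tmul (n : N) (c : C.carrier) :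
    C.cofreeCounit N (tmul k A n c) = op (C.counit c) • n := (rfl)

theorem Coring.cofreeCounit_op_smul (a : A) (z : BalTensor k A N C.carrier) :
    C.cofreeCounit N (op a • z) = op a • C.cofreeCounit N z := by
  induction z using BalTensor.induction with
  | zero => simp
  | tmul n c => simp [right_smul_tmul, C.counit_op_smul, mul_smul]
  | add y z hy hz => simp only [smul_add, map_add, hy, hz]

/-- The left counit axiom `ε(c⁽¹⁾) c⁽²⁾ = c` tensored with `N`. It is the reason why a colinear map
into `N ⊗_A C` can be rebuilt from its composite with `N ⊗ ε`. -/
theorem Coring.mapLeft_cofreeCounit_tensorCoact (z : BalTensor k A N C.carrier) :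
    mapLeft (C.cofreeCounit N) C.cofreeCounit_op_smul (tensorCoact N C.comul C.comul_smul z) =
      z := by
  induction z using BalTensor.induction with
  | zero => simp
  | add y z hy hz => simp only [map_add, hy, hz]
  | tmul n c =>
    rw [tensorCoact_tmul]
    -- Once `c` is expanded as `ε(c⁽¹⁾) c⁽²⁾`, both sides are linear in `Δ(c)`, which may then be
    -- replaced by a pure tensor.
    conv_rhs => rw [← C.counit_comul c]
    generalize C.comul c = w
    induction w using BalTensor.induction with
    | zero => simp [tmul_zero]
    | add y z hy hz => simp only [tmul_add, map_add, hy, hz]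
    | tmul c d => simp [smul_tmul]

variable {C}

/-- Coassociativity with the associator moved to the other side, which is the form that reads as
colinearity of the coaction `X → X ⊗_A C`. -/
theorem RComod.tensorCoact_coact (X : RComod C) (x : X.carrier) :
    tensorCoact X.carrier C.comul C.comul_smul (X.coact x) =
      mapLeft X.coact X.coact_op_smul (X.coact x) := by
  rw [tensorCoact, LinearMap.comp_apply, LinearEquiv.coe_coe, LinearEquiv.symm_apply_eq]
  exact (X.coassoc x).symm

/-- The colinear map `X → N ⊗_A C`, `x ↦ g(x⁽⁰⁾) ⊗ x⁽¹⁾`, induced by a right `A`-linear map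
`g : X → N`. -/
def RComod.toCofree {X : RComod C} (g : X.carrier →ₗ[k] N)
    (hg : ∀ (a : A) (x : X.carrier), g (op a • x) = op a • g x) : X ⟶ C.cofree N :=
  RComod.Hom.mk (N := C.cofree N) ((mapLeft g hg).comp X.coact)
    (fun a x => (congrArg (mapLeft g hg) (X.coact_op_smul a x)).trans (mapLeft_op_smul g hg a _))
    fun x => by
      refine (tensorCoact_mapLeft C.comul C.comul_smul g hg (X.coact x)).trans ?_
      rw [X.tensorCoact_coact, mapLeft_mapLeft]
      rfl

theorem RComod.lin_toCofree {X : RComod C} (g : X.carrier →ₗ[k] N)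
    (hg : ∀ (a : A) (x : X.carrier), g (op a • x) = op a • g x) (x : X.carrier) :
    RComod.Hom.lin (RComod.toCofree g hg) x = mapLeft g hg (X.coact x) := (rfl)

/-- One half of the cofree adjunction: `g(x⁰) ε(x¹) = g(x⁰ ε(x¹)) = g(x)`, by linearity of `g` and
the counit axiom of `X`. -/
theorem RComod.cofreeCounit_toCofree {X : RComod C} (g : X.carrier →ₗ[k] N)
    (hg : ∀ (a : A) (x : X.carrier), g (op a • x) = op a • g x) (x : X.carrier) :
    C.cofreeCounit N (RComod.Hom.lin (RComod.toCofree g hg) x) = g x :=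
  (contractRight_mapLeft C.counit C.counit_smul g hg (X.coact x)).trans (congrArg g (X.counit x))

/-- The right `A`-linear map `X → N` corresponding to a colinear map `X → N ⊗_A C`. -/
def RComod.ofCofree {X : RComod C} (f : X ⟶ C.cofree N) : X.carrier →ₗ[k] N :=
  (C.cofreeCounit N).comp (RComod.Hom.lin f)

theorem RComod.ofCofree_op_smul {X : RComod C} (f : X ⟶ C.cofree N) (a : A) (x : X.carrier) :
    RComod.ofCofree f (op a • x) = op a • RComod.ofCofree f x :=
  (congrArg _ (RComod.Hom.lin_op_smul f a x)).trans (C.cofreeCounit_op_smul a _)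

/-- The other half: colinearity of `f` moves the coaction from `X` to `N ⊗_A C`, where `N ⊗ ε ⊗ C`
undoes `N ⊗ Δ`. -/
theorem RComod.toCofree_ofCofree {X : RComod C} (f : X ⟶ C.cofree N) :
    RComod.toCofree (RComod.ofCofree f) (RComod.ofCofree_op_smul f) = f :=
  RComod.hom_ext fun x => by
    rw [RComod.lin_toCofree]
    refine Eq.trans ?_ (C.mapLeft_cofreeCounit_tensorCoact (RComod.Hom.lin f x))
    refine Eq.trans ?_ (congrArg _ (RComod.Hom.coact_lin f x).symm)
    exact (mapLeft_mapLeft (RComod.Hom.lin f) (RComod.Hom.lin_op_smul f) _ _ _).symm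

/-- A colinear map into `N ⊗_A C` is determined by its composite with `N ⊗_A ε`. -/
theorem RComod.cofree_hom_ext {X : RComod C} {f g : X ⟶ C.cofree N}
    (h : ∀ x, C.cofreeCounit N (RComod.Hom.lin f x) = C.cofreeCounit N (RComod.Hom.lin g x)) :
    f = g := by
  rw [← RComod.toCofree_ofCofree f, ← RComod.toCofree_ofCofree g]
  have : RComod.ofCofree f = RComod.ofCofree g := LinearMap.ext h
  exact RComod.hom_ext fun x => mapLeft_congr this (RComod.ofCofree_op_smul f)
    (RComod.ofCofree_op_smul g) _

/-- The coaction of `X`, as a colinear map `X → X ⊗_A C`. -/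
def RComod.coactHom (X : RComod C) : X ⟶ C.cofree X.carrier :=
  RComod.Hom.mk (N := C.cofree X.carrier) X.coact X.coact_op_smul X.tensorCoact_coact

variable (C) in
/-- The colinear map `C → N ⊗_A C`, `c ↦ n ⊗ c`. -/
def Coring.tmulHom (n : N) : C.regular ⟶ C.cofree N :=
  RComod.Hom.mk (M := C.regular) (N := C.cofree N) (BalTensor.mk k A N C.carrier n)
    (fun a (c : C.carrier) => (right_smul_tmul a n c).symm) fun c => by
      refine (tensorCoact_tmul C.comul C.comul_smul n c).trans ?_
      change _ = mapLeft _ _ (C.comul c)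
      generalize C.comul c = w
      induction w using BalTensor.induction with
      | zero => simp [tmul_zero]
      | add y z hy hz => simp only [tmul_add, map_add, hy, hz]
      | tmul c d =>
        rw [assoc_symm_tmul]
        rfl

variable (C) in
/-- Left multiplication by `a`, as a colinear endomorphism of `C`. -/
def Coring.lmulHom (a : A) : C.regular ⟶ C.regular :=
  RComod.Hom.mk (M := C.regular) (N := C.regular) (Module.toModuleEnd k (S := A) C.carrier a)
    (fun b (c : C.carrier) => smul_comm a (op b) c) fun c => C.comul_smul a c

/-! ### Natural families of endomorphisms of comodules are determined at `C`. -/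

section NaturalFamily

variable (ζ : ∀ M : RComod C, M.carrier →ₗ[k] M.carrier)

/-- The component at `C` of a family of endomorphisms. -/
def familyAt : C.carrier →ₗ[k] C.carrier := ζ C.regular

/-- Left multiplication by `a` is a right colinear endomorphism of `C`, so this is an instance of
naturality. -/
theorem familyAt_smul (hζ : ∀ {M N : RComod C} (f : M ⟶ N) (m : M.carrier),
    ζ N (RComod.Hom.lin f m) = RComod.Hom.lin f (ζ M m)) (a : A) (c : C.carrier) : familyAt ζ (a • c) = a • familyAt ζ c :=
  hζ (C.lmulHom a) c

/-- Naturality is used twice: along the coaction `M → M ⊗_A C`, which moves the question to the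
cofree comodule, and along `c ↦ n ⊗ c`, which shows that `ζ` acts there on the factor `C` only. For
`M = C` it says that `ζ_C` is left colinear. -/
theorem coact_family (hζ : ∀ {M N : RComod C} (f : M ⟶ N) (m : M.carrier),
    ζ N (RComod.Hom.lin f m) = RComod.Hom.lin f (ζ M m)) (M : RComod C) (m : M.carrier) :
    M.coact (ζ M m) = mapRight (familyAt ζ) (familyAt_smul ζ hζ) (M.coact m) := by
  refine (hζ M.coactHom m).symm.trans ?_
  change ζ (C.cofree M.carrier) (M.coact m) = _
  generalize M.coact m = z
  induction z using BalTensor.induction with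
  | zero => rw [map_zero]; exact map_zero _
  | add y z hy hz => rw [map_add, ← hy, ← hz]; exact map_add _ y z
  | tmul n c =>
    rw [mapRight_tmul]
    exact hζ (C.tmulHom n) c

/-- A natural family of endomorphisms of all comodules is determined by its component at `C`. -/
theorem family_eq (hζ : ∀ {M N : RComod C} (f : M ⟶ N) (m : M.carrier),
    ζ N (RComod.Hom.lin f m) = RComod.Hom.lin f (ζ M m)) (M : RComod C) (m : M.carrier) :
    ζ M m = contractRight (C.counit.comp (familyAt ζ))
      (fun a c => by
        rw [LinearMap.comp_apply, familyAt_smul ζ hζ, C.counit_smul, LinearMap.comp_apply])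
      (M.coact m) := by
  rw [← M.counit (ζ M m), coact_family ζ hζ]
  exact (contractRight_comp _ _ _ _ _).symm

end NaturalFamily

end Cofree

/-! ### Natural endomorphisms of `U` and bicomodule endomorphisms of `C`. -/

section UU

variable {k A L : Type u} [CommRing k] [Ring A] [Algebra k A] [Ring L] [Algebra k L]
  {C : Coring k A} {D : Coring k L}
  [Module Lᵐᵒᵖ C.carrier] [IsScalarTower k Lᵐᵒᵖ C.carrier] [SMulCommClass A Lᵐᵒᵖ C.carrier]
  {E : CoringExtension C D}

namespace EndCD

theorem lin_smul (u : EndCD E) (a : A) (c : C.carrier) :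
    endLin E u.1 (a • c) = a • endLin E u.1 c := by
  obtain ⟨hu, -⟩ := u.2
  exact hu a c

theorem comul_lin (u : EndCD E) (c : C.carrier) :
    C.comul (endLin E u.1 c) = mapRight (endLin E u.1) (EndCD.lin_smul u) (C.comul c) := by
  obtain ⟨_, hu⟩ := u.2
  exact hu c

theorem lin_op_smul (u : EndCD E) (l : L) (c : C.carrier) :
    endLin E u.1 (op l • c) = op l • endLin E u.1 c :=
  RComod.Hom.lin_op_smul (M := E.comodC) (N := E.comodC) u.1 l c

theorem coact_lin (u : EndCD E) (c : C.carrier) :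
    E.coact (endLin E u.1 c) = mapLeft (endLin E u.1) (EndCD.lin_op_smul u) (E.coact c) :=
  RComod.Hom.coact_lin (M := E.comodC) (N := E.comodC) u.1 c

theorem counit_lin_smul (u : EndCD E) (a : A) (c : C.carrier) :
    (C.counit.comp (endLin E u.1)) (a • c) = a * (C.counit.comp (endLin E u.1)) c := by
  rw [LinearMap.comp_apply, (EndCD.lin_smul u), C.counit_smul, LinearMap.comp_apply]

/-- Left colinearity makes `u` recoverable from `ε ∘ u`: `c⁽¹⁾ ε(u(c⁽²⁾))` is `u(c)⁽¹⁾ ε(u(c)⁽²⁾)`.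
-/
theorem contractRight_comul (u : EndCD E) (c : C.carrier) :
    contractRight (C.counit.comp (endLin E u.1)) (EndCD.counit_lin_smul u) (C.comul c) =
      endLin E u.1 c := by
  rw [contractRight_comp C.counit C.counit_smul _ (EndCD.lin_smul u), ← (EndCD.comul_lin u), C.comul_counit]

/-- The endomorphism `m ↦ m⁽⁰⁾ ε(u(m⁽¹⁾))` of a right `C`-comodule `M`. -/
def onComod (u : EndCD E) (M : RComod C) : M.carrier →ₗ[k] M.carrier :=
  (contractRight (C.counit.comp (endLin E u.1)) (EndCD.counit_lin_smul u)).comp M.coact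

theorem onComod_apply (u : EndCD E) (M : RComod C) (m : M.carrier) :
    EndCD.onComod u M m = contractRight (C.counit.comp (endLin E u.1)) (EndCD.counit_lin_smul u) (M.coact m) :=
  (rfl)

theorem onComod_naturality (u : EndCD E) {M N : RComod C} (f : M ⟶ N) (m : M.carrier) :
    EndCD.onComod u N (RComod.Hom.lin f m) = RComod.Hom.lin f (EndCD.onComod u M m) := by
  rw [onComod_apply, RComod.Hom.coact_lin, contractRight_mapLeft, onComod_apply]

theorem onComod_regular (u : EndCD E) (c : C.carrier) :
    EndCD.onComod u C.regular c = endLin E u.1 c :=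
  (EndCD.contractRight_comul u) c

theorem familyAt_onComod (u : EndCD E) : familyAt (EndCD.onComod u) = endLin E u.1 :=
  LinearMap.ext (EndCD.onComod_regular u)

/-- The maps `onComod u` form a natural family whose component at `C` is `u`, so `coact_family`
applies. -/
theorem coact_onComod (u : EndCD E) (M : RComod C) (m : M.carrier) :
    M.coact (EndCD.onComod u M m) = mapRight (endLin E u.1) (EndCD.lin_smul u) (M.coact m) := by
  rw [coact_family (EndCD.onComod u) (EndCD.onComod_naturality u)]
  simp only [familyAt_onComod]

/-- `EndCD.onComod u M` as a map of `L`-modules. -/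
def onRes (u : EndCD E) (M : RComod C) : E.Res M →ₗ[k] E.Res M := EndCD.onComod u M

theorem rho_onRes (u : EndCD E) (M : RComod C) (m : E.Res M) :
    E.rho M (EndCD.onRes u M m) = mapRight (endLin E u.1) (EndCD.lin_smul u) (E.rho M m) :=
  EndCD.coact_onComod u M m

/-- After the injective map `ρ`, the action of `L` and the endomorphism both live on the factor `C`,
where `u` is right `L`-linear. -/
theorem onRes_op_smul (u : EndCD E) (M : RComod C) (l : L) (m : E.Res M) :
    EndCD.onRes u M (op l • m) = op l • EndCD.onRes u M m :=
  E.rho_injective M <| by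
    rw [(EndCD.rho_onRes u), E.rho_op_smul, E.rho_op_smul, (EndCD.rho_onRes u),
      mapRight_op_smul _ (EndCD.lin_smul u) (EndCD.lin_op_smul u)]

/-- Tested after `ρ ⊗_L D`, injective by purity. There `τ_M` turns into `M ⊗ τ_C`, and the claim
becomes the right `D`-colinearity of `u` tensored with `M`. -/
theorem tau_onRes (hE : E.IsPure) (u : EndCD E) (M : RComod C) (m : E.Res M) :
    hE.tau M (EndCD.onRes u M m) = mapLeft (EndCD.onRes u M) (EndCD.onRes_op_smul u M) (hE.tau M m) :=
  hE.rhoD_injective M <| by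
    rw [hE.rhoD_tau, (EndCD.rho_onRes u), CoringExtension.coactC,
      tensorCoact_mapRight _ E.coact_smul _ E.coact_smul _ (EndCD.lin_smul u) (EndCD.lin_op_smul u) (EndCD.coact_lin u)]
    refine (congrArg _ (hE.rhoD_tau M m).symm).trans ?_
    refine (mapLeft_mapLeft _ _ _ _ _).trans ?_
    refine Eq.trans ?_ (mapLeft_mapLeft _ _ _ _ _).symm
    exact mapLeft_congr (LinearMap.ext fun m => (EndCD.rho_onRes u M m).symm) _ _ _

/-- The natural endomorphism of `U` induced by `u`. -/
def toNat (hE : E.IsPure) (u : EndCD E) : hE.U ⟶ hE.U where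
  app M := RComod.Hom.mk (M := hE.obj M) (N := hE.obj M) (EndCD.onRes u M) (EndCD.onRes_op_smul u M)
    (EndCD.tau_onRes hE u M)
  naturality _ _ f := RComod.hom_ext fun m => (EndCD.onComod_naturality u) f m

end EndCD

namespace CoringExtension

/-- The identity map from the `D`-comodule `C` to `U C`. -/
def toRes (E : CoringExtension C D) : C.carrier →ₗ[k] E.Res C.regular := LinearMap.id

/-- The identity map from `U C` to the `D`-comodule `C`. -/
def ofRes (E : CoringExtension C D) : E.Res C.regular →ₗ[k] C.carrier := LinearMap.id

/-- The map is the identity; the content is that the given right `L`-action on `C` agrees with the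
induced action `c⁽¹⁾ ε(c⁽²⁾ l)`. It follows by applying `Δ`, which is injective and right
`L`-linear. -/
theorem toRes_op_smul (l : L) (c : C.carrier) : E.toRes (op l • c) = op l • E.toRes c :=
  E.rho_injective C.regular <| by
    rw [E.rho_op_smul]
    exact E.comul_op_smul l c

theorem ofRes_op_smul (l : L) (c : E.Res C.regular) : E.ofRes (op l • c) = op l • E.ofRes c :=
  (E.toRes_op_smul l (E.ofRes c)).symm

/-- The induced `D`-coaction on `C` is the given one: by the bicomodule condition the given coaction
solves the equation characterising `τ`, and purity makes the solution unique. -/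
theorem IsPure.tau_regular (hE : E.IsPure) (c : C.carrier) :
    hE.tau C.regular (E.toRes c) = mapLeft E.toRes E.toRes_op_smul (E.coact c) :=
  hE.rhoD_injective C.regular <| by
    rw [hE.rhoD_tau]
    refine Eq.trans ?_ (mapLeft_mapLeft _ _ _ _ _).symm
    rw [coactC, tensorCoact, LinearMap.comp_apply, LinearEquiv.coe_coe,
      LinearEquiv.symm_apply_eq]
    exact (E.compat c).symm

theorem IsPure.coact_ofRes (hE : E.IsPure) (c : E.Res C.regular) :
    E.coact (E.ofRes c) = mapLeft E.ofRes E.ofRes_op_smul (hE.tau C.regular c) := by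
  refine Eq.trans ?_ (congrArg _ (hE.tau_regular (E.ofRes c)).symm)
  refine Eq.trans ?_ (mapLeft_mapLeft _ _ _ _ _).symm
  exact (mapLeft_id (fun _ _ => rfl) _).symm

/-- `C` and `U C` are isomorphic `D`-comodules. -/
def IsPure.toU (hE : E.IsPure) : E.comodC ⟶ hE.U.obj C.regular :=
  RComod.Hom.mk (M := E.comodC) (N := hE.obj C.regular) E.toRes E.toRes_op_smul hE.tau_regular

/-- The inverse of `IsPure.toU`. -/
def IsPure.ofU (hE : E.IsPure) : hE.U.obj C.regular ⟶ E.comodC :=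
  RComod.Hom.mk (M := hE.obj C.regular) (N := E.comodC) E.ofRes E.ofRes_op_smul hE.coact_ofRes

end CoringExtension

section
variable {hE : E.IsPure} (η : hE.U ⟶ hE.U)

/-- The endomorphisms underlying a natural endomorphism of `U`. -/
def natFamilyUU (M : RComod C) : M.carrier →ₗ[k] M.carrier :=
  RComod.Hom.lin (M := hE.U.obj M) (N := hE.U.obj M) (η.app M)

theorem natFamilyUU_naturality {M N : RComod C} (f : M ⟶ N) (m : M.carrier) :
    natFamilyUU η N (RComod.Hom.lin f m) = RComod.Hom.lin f (natFamilyUU η M m) :=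
  congrArg (fun g : hE.U.obj M ⟶ hE.U.obj N => RComod.Hom.lin g m) (η.naturality f)

/-- The bicomodule endomorphism of `C` determined by a natural endomorphism of `U`. -/
def EndCD.ofNat : EndCD E :=
  -- `toU` and `ofU` are identities on elements and only switch between the two presentations of the
  -- `D`-comodule `C`. Left `C`-colinearity is `coact_family` at `C`, whose coaction is `Δ`.
  ⟨hE.toU ≫ η.app C.regular ≫ hE.ofU, familyAt_smul _ (natFamilyUU_naturality η),
    coact_family _ (natFamilyUU_naturality η) C.regular⟩

end

/-- The isomorphism `^C End^D(C) ≃ Nat(U, U)`. -/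
def natEquivUU (hE : E.IsPure) : EndCD E ≃ₗ[k] (hE.U ⟶ hE.U) :=
  -- The equivalence is constructed from the side of natural transformations, because evaluation at
  -- one object is visibly linear there. The other three equivalences follow the same pattern.
  LinearEquiv.symm
  { toFun := EndCD.ofNat
    map_add' _ _ := rfl
    map_smul' _ _ := rfl
    invFun u := EndCD.toNat hE u
    left_inv η := by
      ext M m
      exact (family_eq (natFamilyUU η) (natFamilyUU_naturality η) M m).symm
    right_inv u := Subtype.ext (RComod.hom_ext (EndCD.onComod_regular u)) }

end UU

/-! ### Natural endomorphisms of `V` and `L`-bimodule maps `D → T`. -/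

section VV

variable {k A L : Type u} [CommRing k] [Ring A] [Algebra k A] [Ring L] [Algebra k L]
  {C : Coring k A} {D : Coring k L} {S : BiComod L C}

namespace LHomL

theorem map_smul (v : LHomL D S) (l : L) (d : D.carrier) : v.1 (l • d) = v.1 d ≫ S.lmul l :=
  v.2.1 l d

theorem map_op_smul (v : LHomL D S) (l : L) (d : D.carrier) :
    v.1 (op l • d) = S.lmul l ≫ v.1 d :=
  v.2.2 l d

/-- The map `φ ⊗ d ↦ φ ∘ v(d)`. -/
def precomp (v : LHomL D S) (M : RComod C) :
    BalTensor k L (S.toRComod ⟶ M) D.carrier →ₗ[k] (S.toRComod ⟶ M) :=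
  lift (LinearMap.mk₂ k (fun φ d => v.1 d ≫ φ)
      (fun _ _ _ => Preadditive.comp_add _ _ _ _ _ _)
      (fun _ _ _ => Linear.comp_smul _ _ _ _ _ _)
      (fun _ _ _ => by rw [map_add, Preadditive.add_comp])
      (fun _ _ _ => by rw [_root_.map_smul, Linear.smul_comp]))
    -- Left `L`-linearity of `v` makes the map balanced over `L`; the right `L`-linearity of `v` is
    -- what makes the resulting map right `L`-linear.
    (fun φ l d => by
      simp only [LinearMap.mk₂_apply]
      rw [map_smul, Category.assoc, BiComod.op_smul_def])

@[simp] theorem precomp_tmul (v : LHomL D S) {M : RComod C} (φ : S.toRComod ⟶ M) (d : D.carrier) :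
    precomp v M (tmul k L φ d) = v.1 d ≫ φ := (rfl)

theorem precomp_op_smul (v : LHomL D S) {M : RComod C} (l : L)
    (z : BalTensor k L (S.toRComod ⟶ M) D.carrier) :
    precomp v M (op l • z) = op l • precomp v M z := by
  induction z using BalTensor.induction with
  | zero => simp
  | tmul φ d =>
    rw [right_smul_tmul, precomp_tmul, precomp_tmul, map_op_smul, Category.assoc,
      BiComod.op_smul_def]
  | add y z hy hz => simp only [smul_add, map_add, hy, hz]

theorem precomp_mapLeft (v : LHomL D S) {M N : RComod C} (f : M ⟶ N)
    (z : BalTensor k L (S.toRComod ⟶ M) D.carrier) :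
    precomp v N (mapLeft (S.postcomp f) (S.postcomp_op_smul f) z) = precomp v M z ≫ f := by
  induction z using BalTensor.induction with
  | zero => simp
  | tmul φ d => exact (Category.assoc (v.1 d) φ f).symm
  | add y z hy hz => simp only [map_add, Preadditive.add_comp, hy, hz]

/-- The natural endomorphism of `V` induced by `v`. -/
def toNat (v : LHomL D S) : S.V D ⟶ S.V D where
  app M := RComod.toCofree (X := S.VObj D M) (N := (S.toRComod ⟶ M)) (precomp v M)
    (precomp_op_smul v)
  -- The target `V N` is cofree, so both composites are compared after applying the counit of `D`,
  -- where `precomp_mapLeft` settles the matter.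
  naturality M N f := RComod.cofree_hom_ext (N := (S.toRComod ⟶ N)) fun z => by
    refine (RComod.cofreeCounit_toCofree (X := S.VObj D N) (precomp v N) (precomp_op_smul v)
      (mapLeft (S.postcomp f) (S.postcomp_op_smul f) z)).trans ?_
    refine (precomp_mapLeft v f z).trans ?_
    refine Eq.trans ?_ (contractRight_mapLeft D.counit D.counit_smul (S.postcomp f)
      (S.postcomp_op_smul f) _).symm
    exact congrArg (· ≫ f) (RComod.cofreeCounit_toCofree (X := S.VObj D M) (precomp v M)
      (precomp_op_smul v) z).symm

theorem cofreeCounit_toNat (v : LHomL D S) (M : RComod C)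
    (z : BalTensor k L (S.toRComod ⟶ M) D.carrier) :
    D.cofreeCounit (S.toRComod ⟶ M) (RComod.Hom.lin ((toNat v).app M) z) = precomp v M z :=
  RComod.cofreeCounit_toCofree (X := S.VObj D M) (precomp v M) (precomp_op_smul v) z

/-- The explicit value `φ ⊗ d ↦ φ v(d₁) ⊗ d₂`, needed to compute composites that start with `toNat
v`. -/
theorem lin_toNat_tmul (v : LHomL D S) (M : RComod C) (φ : S.toRComod ⟶ M) (d : D.carrier) :
    RComod.Hom.lin ((toNat v).app M) (tmul k L φ d) =
      mapLeft (precomp v M) (precomp_op_smul v) (assoc.symm (tmul k L φ (D.comul d))) :=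
  congrArg (mapLeft (precomp v M) (precomp_op_smul v))
    (tensorCoact_tmul D.comul D.comul_smul φ d)

end LHomL

section
variable (η : S.V D ⟶ S.V D)

/-- The composite of a component of a natural endomorphism of `V` with
`Hom^C(Σ, M) ⊗_L ε`. -/
def natFamilyVV (M : RComod C) :
    BalTensor k L (S.toRComod ⟶ M) D.carrier →ₗ[k] (S.toRComod ⟶ M) :=
  RComod.ofCofree (X := S.VObj D M) (N := (S.toRComod ⟶ M)) (η.app M)

theorem natFamilyVV_naturality {M N : RComod C} (f : M ⟶ N)
    (z : BalTensor k L (S.toRComod ⟶ M) D.carrier) :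
    natFamilyVV η N (mapLeft (S.postcomp f) (S.postcomp_op_smul f) z) = natFamilyVV η M z ≫ f := by
  refine (congrArg (fun g : S.VObj D M ⟶ S.VObj D N =>
    D.cofreeCounit (S.toRComod ⟶ N) (RComod.Hom.lin g z)) (η.naturality f)).trans ?_
  exact contractRight_mapLeft D.counit D.counit_smul (S.postcomp f) (S.postcomp_op_smul f) _

theorem natFamilyVV_op_smul (M : RComod C) (l : L)
    (z : BalTensor k L (S.toRComod ⟶ M) D.carrier) :
    natFamilyVV η M (op l • z) = op l • natFamilyVV η M z :=
  RComod.ofCofree_op_smul (X := S.VObj D M) (N := (S.toRComod ⟶ M)) (η.app M) l z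

/-- The Yoneda argument: `φ ⊗ d` is the image of `id ⊗ d` under `V φ`, so naturality along `φ`
leaves only the values at `id ⊗ d`. -/
theorem natFamilyVV_tmul {M : RComod C} (φ : S.toRComod ⟶ M) (d : D.carrier) :
    natFamilyVV η M (tmul k L φ d) = natFamilyVV η S.toRComod (tmul k L (𝟙 S.toRComod) d) ≫ φ := by
  rw [← natFamilyVV_naturality, mapLeft_tmul]
  exact congrArg (fun ψ => natFamilyVV η M (tmul k L ψ d)) (Category.id_comp φ).symm

/-- The bimodule map `D → T` determined by a natural endomorphism of `V`. -/
def LHomL.ofNat : LHomL D S :=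
  ⟨(natFamilyVV η S.toRComod).comp (BalTensor.mk k L (S.toRComod ⟶ S.toRComod) D.carrier (𝟙 _)),
    -- Moving `l` across the tensor sign turns `id ⊗ l d` into (left multiplication by `l`) `⊗ d`,
    -- and the Yoneda argument applies to that endomorphism of `Σ`.
    fun l d => by
      rw [LinearMap.comp_apply, LinearMap.comp_apply, mk_apply, mk_apply, ← smul_tmul,
        BiComod.op_smul_def, Category.comp_id, natFamilyVV_tmul],
    -- Here `id ⊗ d l = (id ⊗ d) l`, and components of a transformation are right `L`-linear.
    fun l d => by
      rw [LinearMap.comp_apply, LinearMap.comp_apply, mk_apply, mk_apply, ← right_smul_tmul,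
        natFamilyVV_op_smul, BiComod.op_smul_def]⟩

end

variable (D S) in
/-- The isomorphism `_L Hom_L(D, T) ≃ Nat(V, V)`. -/
def natEquivVV : LHomL D S ≃ₗ[k] (S.V D ⟶ S.V D) :=
  LinearEquiv.symm
  { toFun := LHomL.ofNat
    map_add' η θ := Subtype.ext <| LinearMap.ext fun d => map_add (D.cofreeCounit _) _ _
    map_smul' c η := Subtype.ext <| LinearMap.ext fun d => map_smul (D.cofreeCounit _) _ _
    invFun v := LHomL.toNat v
    left_inv η := by
      ext M : 2
      refine RComod.cofree_hom_ext (N := (S.toRComod ⟶ M)) fun z => ?_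
      refine (LHomL.cofreeCounit_toNat _ M z).trans ?_
      change _ = natFamilyVV η M z
      refine LinearMap.congr_fun (BalTensor.hom_ext fun φ d => ?_) z
      exact (natFamilyVV_tmul η φ d).symm
    right_inv v := Subtype.ext <| LinearMap.ext fun d =>
      (LHomL.cofreeCounit_toNat v _ _).trans (Category.comp_id (v.1 d)) }

end VV

/-! ### Natural transformations `V → U` and left `L`-linear colinear maps `D → Σ`. -/

section VU

variable {k A L : Type u} [CommRing k] [Ring A] [Algebra k A] [Ring L] [Algebra k L]
  {C : Coring k A} {D : Coring k L}
  [Module Lᵐᵒᵖ C.carrier] [IsScalarTower k Lᵐᵒᵖ C.carrier] [SMulCommClass A Lᵐᵒᵖ C.carrier]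
  {E : CoringExtension C D} {hE : E.IsPure} {S : BiComod L C}

namespace LHomD

/-- `p` as a map of `L`-modules to `E.Res Σ`. -/
def toRes (p : LHomD hE S) : D.carrier →ₗ[k] E.Res S.toRComod := colin hE S p.1

theorem toRes_op_smul (p : LHomD hE S) (l : L) (d : D.carrier) :
    toRes p (op l • d) = op l • toRes p d :=
  RComod.Hom.lin_op_smul (M := D.regular) (N := hE.obj S.toRComod) p.1 l d

theorem tau_toRes (p : LHomD hE S) (d : D.carrier) :
    hE.tau S.toRComod (toRes p d) = mapLeft (toRes p) (toRes_op_smul p) (D.comul d) :=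
  RComod.Hom.coact_lin (M := D.regular) (N := hE.obj S.toRComod) p.1 d

/-- The map `φ ⊗ d ↦ φ(p(d))`. -/
def eval (p : LHomD hE S) (M : RComod C) :
    BalTensor k L (S.toRComod ⟶ M) D.carrier →ₗ[k] E.Res M :=
  lift (LinearMap.mk₂ k (fun φ d => E.resMap φ (toRes p d))
      (fun _ _ _ => rfl) (fun _ _ _ => rfl)
      (fun _ _ _ => by rw [map_add, map_add])
      (fun _ _ _ => by rw [map_smul, map_smul]))
    -- Balancedness, `(φ l)(p(d)) = φ(l p(d)) = φ(p(l d))`, is the left `L`-linearity of `p`.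
    (fun φ l d => congrArg (RComod.Hom.lin φ) (p.2 l d).symm)

@[simp] theorem eval_tmul (p : LHomD hE S) {M : RComod C} (φ : S.toRComod ⟶ M) (d : D.carrier) :
    eval p M (tmul k L φ d) = E.resMap φ (toRes p d) := (rfl)

theorem eval_op_smul (p : LHomD hE S) (M : RComod C) (l : L)
    (z : BalTensor k L (S.toRComod ⟶ M) D.carrier) :
    eval p M (op l • z) = op l • eval p M z := by
  induction z using BalTensor.induction with
  | zero => simp
  | tmul φ d => rw [right_smul_tmul, eval_tmul, eval_tmul, toRes_op_smul, E.resMap_op_smul]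
  | add y z hy hz => simp only [smul_add, map_add, hy, hz]

/-- The map `U φ` is `D`-colinear because `U` is a functor, and `p` is `D`-colinear by assumption;
on `φ ⊗ d` the claim is the colinearity of their composite. -/
theorem tau_eval (p : LHomD hE S) (M : RComod C)
    (z : BalTensor k L (S.toRComod ⟶ M) D.carrier) :
    hE.tau M (eval p M z) = mapLeft (eval p M) (eval_op_smul p M)
      (tensorCoact (S.toRComod ⟶ M) D.comul D.comul_smul z) := by
  induction z using BalTensor.induction with
  | zero => simp
  | add y z hy hz => simp only [map_add, hy, hz]
  | tmul φ d =>
    rw [eval_tmul, tensorCoact_tmul]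
    refine (RComod.Hom.coact_lin (hE.U.map φ) (toRes p d)).trans ?_
    refine (congrArg _ (tau_toRes p d)).trans ?_
    change mapLeft (E.resMap φ) (E.resMap_op_smul φ) _ = _
    generalize D.comul d = w
    induction w using BalTensor.induction with
    | zero => simp [tmul_zero]
    | add y z hy hz => simp only [tmul_add, map_add, hy, hz]
    | tmul c d => rfl

theorem eval_mapLeft (p : LHomD hE S) {M N : RComod C} (f : M ⟶ N)
    (z : BalTensor k L (S.toRComod ⟶ M) D.carrier) :
    eval p N (mapLeft (S.postcomp f) (S.postcomp_op_smul f) z) = E.resMap f (eval p M z) := by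
  induction z using BalTensor.induction with
  | zero => simp
  | add y z hy hz => simp only [map_add, hy, hz]
  | tmul φ d => rfl

/-- The natural transformation `V → U` induced by `p`. -/
def toNat (p : LHomD hE S) : S.V D ⟶ hE.U where
  app M := RComod.Hom.mk (M := S.VObj D M) (N := hE.obj M) (eval p M) (eval_op_smul p M)
    (tau_eval p M)
  naturality _ _ f := RComod.hom_ext fun z => eval_mapLeft p f z

end LHomD

section
variable (η : S.V D ⟶ hE.U)

/-- The same Yoneda argument as `natFamilyVV_tmul`, with target `U`. -/
theorem nat_app_tmul {M : RComod C} (φ : S.toRComod ⟶ M) (d : D.carrier) :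
    RComod.Hom.lin (M := S.VObj D M) (N := hE.obj M) (η.app M) (tmul k L φ d) =
      E.resMap φ (RComod.Hom.lin (M := S.VObj D S.toRComod) (N := hE.obj S.toRComod)
        (η.app S.toRComod) (tmul k L (𝟙 S.toRComod) d)) := by
  refine Eq.trans ?_ (congrArg (fun g : S.VObj D S.toRComod ⟶ hE.obj M =>
    RComod.Hom.lin g (tmul k L (𝟙 S.toRComod) d)) (η.naturality φ))
  exact congrArg (fun ψ => RComod.Hom.lin (M := S.VObj D M) (N := hE.obj M) (η.app M)
    (tmul k L ψ d)) (Category.id_comp φ).symm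

/-- The colinear map `D → U Σ` determined by a natural transformation `V → U`. -/
def LHomD.ofNat : LHomD hE S :=
  ⟨D.tmulHom (𝟙 S.toRComod) ≫ (η.app S.toRComod : S.VObj D S.toRComod ⟶ hE.U.obj S.toRComod),
    -- Again `id ⊗ l d` equals (left multiplication by `l`) `⊗ d`, so naturality along left
    -- multiplication by `l` gives left `L`-linearity.
    fun l d => by
      refine Eq.trans ?_ (nat_app_tmul η (S.lmul l) d)
      refine congrArg (RComod.Hom.lin (M := S.VObj D S.toRComod) (N := hE.obj S.toRComod)
        (η.app S.toRComod)) ?_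
      refine (smul_tmul (𝟙 S.toRComod) l d).symm.trans ?_
      rw [BiComod.op_smul_def, Category.comp_id]⟩

end

variable (hE S) in
/-- The isomorphism `_L Hom^D(D, Σ) ≃ Nat(V, U)`. -/
def natEquivVU : LHomD hE S ≃ₗ[k] (S.V D ⟶ hE.U) :=
  LinearEquiv.symm
  { toFun := LHomD.ofNat
    map_add' η θ := rfl
    map_smul' c η := rfl
    invFun p := LHomD.toNat p
    left_inv η := by
      ext M : 2
      refine RComod.hom_ext fun z => ?_
      refine LinearMap.congr_fun (g := RComod.Hom.lin (M := S.VObj D M) (N := hE.obj M) (η.app M))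
        (BalTensor.hom_ext fun φ d => ?_) z
      exact (nat_app_tmul η φ d).symm
    right_inv p := rfl }

end VU

/-! ### Natural transformations `U → V` and the module `Q̃`. -/

section UV

variable {k A L : Type u} [CommRing k] [Ring A] [Algebra k A] [Ring L] [Algebra k L]
  {C : Coring k A}

theorem BalTensor.contractLeft_mapLeft {M M' N : Type u}
    [AddCommGroup M] [Module k M] [Module Aᵐᵒᵖ M] [AddCommGroup M'] [Module k M'] [Module Aᵐᵒᵖ M']
    [AddCommGroup N] [Module k N] [Module A N] [IsScalarTower k A N]
    (f : M' →ₗ[k] A) (hf : ∀ (r : A) (m : M'), f (op r • m) = f m * r)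
    (g : M →ₗ[k] M') (hg : ∀ (r : A) (m : M), g (op r • m) = op r • g m)
    (x : BalTensor k A M N) :
    contractLeft f hf (mapLeft g hg x) =
      contractLeft (f.comp g) (fun r m => by simp [hf, hg]) x := by
  induction x using BalTensor.induction with
  | zero => simp
  | tmul m n => simp
  | add y z hy hz => simp only [map_add, hy, hz]

/-- `ε(c⁽¹⁾ f(c⁽²⁾)) = ε(c⁽¹⁾) f(c⁽²⁾) = f(ε(c⁽¹⁾) c⁽²⁾) = f(c)`. This is how `q` is recovered from
the transformation it induces. -/
theorem Coring.counit_contractRight (f : C.carrier →ₗ[k] A)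
    (hf : ∀ (a : A) (c : C.carrier), f (a • c) = a * f c) (c : C.carrier) :
    C.counit (contractRight f hf (C.comul c)) = f c := by
  conv_rhs => rw [← C.counit_comul c]
  generalize C.comul c = z
  induction z using BalTensor.induction with
  | zero => simp
  | tmul m n => simp [hf, C.counit_op_smul]
  | add y z hy hz => simp only [map_add, hy, hz]

variable {D : Coring k L}
  [Module Lᵐᵒᵖ C.carrier] [IsScalarTower k Lᵐᵒᵖ C.carrier] [SMulCommClass A Lᵐᵒᵖ C.carrier]
  {E : CoringExtension C D} {S : BiComod L C}

namespace Qtilde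

theorem evalAt_smul (q : Qtilde S) (x : S.carrier) (a : A) (c : C.carrier) :
    evalAt q.1 x (a • c) = a * evalAt q.1 x c :=
  q.2.1 x a c

theorem apply_op_smul (q : Qtilde S) (l : L) (c : C.carrier) (x : S.carrier) :
    dualLin S (q.1 (op l • c)) x = dualLin S (q.1 c) (l • x) := by
  obtain ⟨-, hL, -⟩ := q.2
  exact hL l c x

theorem contractRight_comul (q : Qtilde S) (x : S.carrier) (c : C.carrier) :
    contractRight (evalAt q.1 x) (evalAt_smul q x) (C.comul c) =
      contractLeft (dualLin S (q.1 c)) (dualLin_op_smul S (q.1 c)) (S.coact x) := by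
  obtain ⟨_, -, hq⟩ := q.2
  exact hq x c

/-- The map `m ⊗ c ↦ (x ↦ m q(c)(x))`. -/
def contract (q : Qtilde S) (M : RComod C) :
    BalTensor k A M.carrier C.carrier →ₗ[k] S.carrier →ₗ[k] M.carrier :=
  LinearMap.mk₂ k (fun z x => contractRight (evalAt q.1 x) (evalAt_smul q x) z)
    (fun _ _ _ => map_add _ _ _) (fun _ _ _ => map_smul _ _ _)
    (fun z x y => by
      induction z using BalTensor.induction with
      | zero => simp
      | tmul m c => simp [add_smul]
      | add z w hz hw => rw [map_add, map_add, map_add, hz, hw, add_add_add_comm])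
    (fun r z x => by
      induction z using BalTensor.induction with
      | zero => simp
      | tmul m c => simp
      | add z w hz hw => rw [map_add, map_add, hz, hw, smul_add])

theorem contract_apply (q : Qtilde S) (M : RComod C)
    (z : BalTensor k A M.carrier C.carrier) (x : S.carrier) :
    contract q M z x = contractRight (evalAt q.1 x) (evalAt_smul q x) z := (rfl)

@[simp] theorem contract_tmul (q : Qtilde S) (M : RComod C) (m : M.carrier) (c : C.carrier)
    (x : S.carrier) : contract q M (tmul k A m c) x = op (dualLin S (q.1 c) x) • m := (rfl)

theorem contract_op_smul (q : Qtilde S) (M : RComod C)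
    (z : BalTensor k A M.carrier C.carrier) (a : A) (x : S.carrier) :
    contract q M z (op a • x) = op a • contract q M z x := by
  induction z using BalTensor.induction with
  | zero => simp
  | tmul m c => simp [dualLin_op_smul, mul_smul]
  | add z w hz hw => simp only [map_add, LinearMap.add_apply, smul_add, hz, hw]

theorem contract_right_op_smul (q : Qtilde S) (M : RComod C)
    (z : BalTensor k A M.carrier C.carrier) (l : L) (x : S.carrier) :
    contract q M (op l • z) x = contract q M z (l • x) := by
  induction z using BalTensor.induction with
  | zero => simp
  | tmul m c => rw [right_smul_tmul, contract_tmul, contract_tmul, apply_op_smul]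
  | add z w hz hw => simp only [map_add, LinearMap.add_apply, smul_add, hz, hw]

/-- The defining equation of `Q̃` tensored with `M`: on `m ⊗ c` the left side is `m q(c)(x⁰) ⊗ x¹ =
m ⊗ q(c)(x⁰) x¹`, which equals `m ⊗ c⁽¹⁾ q(c⁽²⁾)(x)`. -/
theorem mapLeft_contract (q : Qtilde S) (M : RComod C)
    (z : BalTensor k A M.carrier C.carrier) (x : S.carrier) :
    mapLeft (contract q M z) (contract_op_smul q M z) (S.coact x) =
      mapRight (contractRight (evalAt q.1 x) (evalAt_smul q x))
        (contractRight_smul (evalAt q.1 x) (evalAt_smul q x))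
        (mapRight C.comul C.comul_smul z) := by
  -- On the left `z` occurs inside the map being tensored, so additivity in `z` is not an instance
  -- of `map_add`; the zero and sum cases need a second induction, on the coaction of `x`.
  induction z using BalTensor.induction with
  | zero =>
    refine Eq.trans ?_ ((congrArg _ (map_zero _)).trans (map_zero _)).symm
    generalize S.coact x = w
    induction w using BalTensor.induction with
    | zero => simp
    | tmul y c => simp [zero_tmul]
    | add y z hy hz => rw [map_add, hy, hz, add_zero]
  | tmul m c =>
    rw [mapRight_tmul, mapRight_tmul, contractRight_comul]
    generalize S.coact x = w
    induction w using BalTensor.induction with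
    | zero => simp [tmul_zero]
    | tmul y c => simp [smul_tmul]
    | add y z hy hz => rw [map_add, hy, hz, map_add, tmul_add]
  | add y z hy hz =>
    refine Eq.trans ?_ ((congrArg _ (map_add _ y z)).trans (map_add _ _ _)).symm
    rw [← hy, ← hz]
    generalize S.coact x = w
    induction w using BalTensor.induction with
    | zero => simp
    | tmul y c => simp [add_tmul]
    | add v w hv hw => rw [map_add, hv, hw, map_add, map_add, add_add_add_comm]

/-- Colinearity of `x ↦ m⁰ q(m¹)(x)`. Coassociativity of `M` rewrites its coaction as `m⁰ ⊗ m¹⁽¹⁾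
q(m¹⁽²⁾)(x)`, and `mapLeft_contract` finishes. -/
theorem coact_contract (q : Qtilde S) (M : RComod C) (m : M.carrier) (x : S.carrier) :
    M.coact (contract q M (M.coact m) x) =
      mapLeft (contract q M (M.coact m)) (contract_op_smul q M _) (S.coact x) := by
  rw [mapLeft_contract, contract_apply, ← contractRight_mapLeft _ _ M.coact M.coact_op_smul,
    contractRight_assoc, M.coassoc]

/-- The map `m ↦ (x ↦ m⁽⁰⁾ q(m⁽¹⁾)(x))`. -/
def hom (q : Qtilde S) (M : RComod C) : M.carrier →ₗ[k] (S.toRComod ⟶ M) where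
  toFun m := RComod.Hom.mk (contract q M (M.coact m)) (contract_op_smul q M _)
    (coact_contract q M m)
  map_add' m n := RComod.hom_ext fun x => by simp
  map_smul' r m := RComod.hom_ext fun x => by simp

theorem lin_hom (q : Qtilde S) (M : RComod C) (m : M.carrier) (x : S.carrier) :
    RComod.Hom.lin (hom q M m) x = contractRight (evalAt q.1 x) (evalAt_smul q x) (M.coact m) :=
  (rfl)

theorem hom_naturality (q : Qtilde S) {M N : RComod C} (f : M ⟶ N) (m : M.carrier) :
    hom q N (RComod.Hom.lin f m) = hom q M m ≫ f :=
  RComod.hom_ext fun x => by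
    rw [lin_hom, RComod.Hom.coact_lin, contractRight_mapLeft, RComod.Hom.lin_comp, lin_hom]

/-- `hom q M` as a map of `L`-modules. -/
def homRes (E : CoringExtension C D) (q : Qtilde S) (M : RComod C) :
    E.Res M →ₗ[k] (S.toRComod ⟶ M) := hom q M

theorem homRes_op_smul (q : Qtilde S) (M : RComod C) (l : L) (m : E.Res M) :
    homRes E q M (op l • m) = op l • homRes E q M m :=
  RComod.hom_ext fun x => by
    refine Eq.trans ?_ (contract_right_op_smul q M (M.coact m) l x)
    exact congrArg (fun z => contract q M z x) (E.rho_op_smul M l m)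

/-- The natural transformation `U → V` induced by `q`. -/
def toNat (hE : E.IsPure) (q : Qtilde S) : hE.U ⟶ S.V D where
  app M := RComod.toCofree (X := hE.obj M) (N := (S.toRComod ⟶ M)) (homRes E q M)
    (homRes_op_smul q M)
  naturality M N f := RComod.cofree_hom_ext (N := (S.toRComod ⟶ N)) fun m => by
    refine (RComod.cofreeCounit_toCofree (X := hE.obj N) (homRes E q N) (homRes_op_smul q N)
      (E.resMap f m)).trans ?_
    refine (hom_naturality q f m).trans ?_
    refine Eq.trans ?_ (contractRight_mapLeft D.counit D.counit_smul (S.postcomp f)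
      (S.postcomp_op_smul f) _).symm
    exact congrArg (· ≫ f) (RComod.cofreeCounit_toCofree (X := hE.obj M) (homRes E q M)
      (homRes_op_smul q M) m).symm

theorem cofreeCounit_toNat (hE : E.IsPure) (q : Qtilde S) (M : RComod C) (m : E.Res M) :
    D.cofreeCounit (S.toRComod ⟶ M) (RComod.Hom.lin ((toNat hE q).app M) m) = hom q M m :=
  RComod.cofreeCounit_toCofree (X := hE.obj M) (homRes E q M) (homRes_op_smul q M) m

theorem counit_lin_hom_regular (q : Qtilde S) (c : C.carrier) (x : S.carrier) :
    C.counit (RComod.Hom.lin (hom q C.regular c) x) = dualLin S (q.1 c) x :=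
  C.counit_contractRight (evalAt q.1 x) (evalAt_smul q x) c

end Qtilde

section
variable {hE : E.IsPure} (η : hE.U ⟶ S.V D)

/-- The composite of a component of a natural transformation `U → V` with
`Hom^C(Σ, M) ⊗_L ε`. -/
def natFamilyUV (M : RComod C) : M.carrier →ₗ[k] (S.toRComod ⟶ M) :=
  RComod.ofCofree (X := hE.obj M) (N := (S.toRComod ⟶ M)) (η.app M)

theorem natFamilyUV_naturality {M N : RComod C} (f : M ⟶ N) (m : M.carrier) :
    natFamilyUV η N (RComod.Hom.lin f m) = natFamilyUV η M m ≫ f := by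
  refine (congrArg (fun g : hE.obj M ⟶ S.VObj D N =>
    D.cofreeCounit (S.toRComod ⟶ N) (RComod.Hom.lin g m)) (η.naturality f)).trans ?_
  exact contractRight_mapLeft D.counit D.counit_smul (S.postcomp f) (S.postcomp_op_smul f) _

/-- The components of `η` are linear for the induced action of `L` on `U C`; `toRes_op_smul`
replaces it by the given action on `C`. -/
theorem natFamilyUV_op_smul (l : L) (c : C.carrier) :
    natFamilyUV η C.regular (op l • c : C.carrier) = op l • natFamilyUV η C.regular c := by
  refine Eq.trans ?_ (RComod.ofCofree_op_smul (X := hE.obj C.regular)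
    (N := (S.toRComod ⟶ C.regular)) (η.app C.regular) l (E.toRes c))
  exact congrArg (RComod.ofCofree (X := hE.obj C.regular)
    (N := (S.toRComod ⟶ C.regular)) (η.app C.regular)) (E.toRes_op_smul l c)

/-- The natural family of maps `m ↦ θ(m)(x)` for a natural transformation `U → V` and `x ∈ Σ`. -/
def natFamilyUVAt (x : S.carrier) (M : RComod C) : M.carrier →ₗ[k] M.carrier where
  toFun m := RComod.Hom.lin (natFamilyUV η M m) x
  map_add' m n := by rw [map_add, RComod.Hom.lin_add, LinearMap.add_apply]
  map_smul' r m := by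
    rw [map_smul, RComod.Hom.lin_smul, LinearMap.smul_apply, RingHom.id_apply]

/-- Evaluation at a fixed `x` reduces transformations `U → V` to natural families of endomorphisms,
to which `family_eq` applies. -/
theorem natFamilyUVAt_naturality (x : S.carrier) {M N : RComod C} (f : M ⟶ N) (m : M.carrier) :
    natFamilyUVAt η x N (RComod.Hom.lin f m) = RComod.Hom.lin f (natFamilyUVAt η x M m) :=
  congrArg (fun g => RComod.Hom.lin g x) (natFamilyUV_naturality η f m)

/-- The map `c ↦ (x ↦ ε(θ(c)(x)))` determined by a natural transformation `U → V`. -/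
def natDual : C.carrier →ₗ[k] Dual S where
  toFun c := show S.carrier →ₗ[Aᵐᵒᵖ] A from
    { toFun x := C.counit (natFamilyUVAt η x C.regular c)
      map_add' x y := by
        refine (congrArg C.counit ?_).trans (map_add C.counit _ _)
        exact map_add (RComod.Hom.lin (natFamilyUV η C.regular c)) x y
      map_smul' a x := by
        refine (congrArg C.counit ?_).trans (C.counit_op_smul (unop a) _)
        exact RComod.Hom.lin_op_smul (natFamilyUV η C.regular c) (unop a) x }
  map_add' c c' := LinearMap.ext fun x =>
    (congrArg C.counit (map_add (natFamilyUVAt η x C.regular) c c')).trans (map_add C.counit _ _)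
  map_smul' r c := LinearMap.ext fun x =>
    (congrArg C.counit (map_smul (natFamilyUVAt η x C.regular) r c)).trans (map_smul C.counit _ _)

theorem evalAt_natDual (x : S.carrier) :
    evalAt (natDual η) x = C.counit.comp (familyAt (natFamilyUVAt η x)) := (rfl)

/-- The element of `Q̃` determined by a natural transformation `U → V`. -/
def Qtilde.ofNat : Qtilde S :=
  ⟨natDual η, fun x a c => by
      rw [evalAt_natDual, LinearMap.comp_apply,
        familyAt_smul _ (natFamilyUVAt_naturality η x), C.counit_smul, LinearMap.comp_apply],
    fun l c x => congrArg (fun φ => C.counit (RComod.Hom.lin φ x)) (natFamilyUV_op_smul η l c),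
    fun x c => by
      -- Both sides of the equation equal `θ_C(c)(x)`, where `θ_C(c) : Σ → C`: the left by
      -- `family_eq` at `C`, the right by applying `ε ⊗ C` to the colinearity of `θ_C(c)`.
      refine (family_eq _ (natFamilyUVAt_naturality η x) C.regular c).symm.trans ?_
      have h := congrArg (contractLeft C.counit C.counit_op_smul)
        (RComod.Hom.coact_lin (natFamilyUV η C.regular c) x)
      refine ((C.counit_comul (natFamilyUVAt η x C.regular c)).symm.trans h).trans ?_
      exact contractLeft_mapLeft C.counit C.counit_op_smul
        (RComod.Hom.lin (natFamilyUV η C.regular c)) _ _⟩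

theorem Qtilde.dualLin_ofNat (c : C.carrier) (x : S.carrier) :
    dualLin S ((Qtilde.ofNat η).1 c) x = C.counit (RComod.Hom.lin (D.cofreeCounit
      (S.toRComod ⟶ C.regular) (RComod.Hom.lin (η.app C.regular) c)) x) := (rfl)

end

theorem Qtilde.ext {q q' : Qtilde S}
    (h : ∀ c x, dualLin S (q.1 c) x = dualLin S (q'.1 c) x) : q = q' :=
  Subtype.ext <| LinearMap.ext fun c => LinearMap.ext (h c)

variable (S) in
/-- The isomorphism `Q̃ ≃ Nat(U, V)`. -/
def natEquivUV (hE : E.IsPure) : Qtilde S ≃ₗ[k] (hE.U ⟶ S.V D) :=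
  LinearEquiv.symm
  { toFun := Qtilde.ofNat
    map_add' η θ := Qtilde.ext fun c x => by
      rw [Qtilde.dualLin_ofNat]
      refine (congrArg (fun φ => C.counit (RComod.Hom.lin φ x))
        (map_add (D.cofreeCounit (S.toRComod ⟶ C.regular)) _ _)).trans ?_
      exact map_add C.counit _ _
    map_smul' r η := Qtilde.ext fun c x => by
      rw [Qtilde.dualLin_ofNat]
      refine (congrArg (fun φ => C.counit (RComod.Hom.lin φ x))
        (map_smul (D.cofreeCounit (S.toRComod ⟶ C.regular)) r _)).trans ?_
      exact map_smul C.counit r _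
    invFun q := Qtilde.toNat hE q
    left_inv η := by
      ext M : 2
      refine RComod.cofree_hom_ext (N := (S.toRComod ⟶ M)) fun m => ?_
      refine (Qtilde.cofreeCounit_toNat hE _ M m).trans ?_
      change _ = natFamilyUV η M m
      refine RComod.hom_ext fun x => ?_
      exact (family_eq _ (natFamilyUVAt_naturality η x) M m).symm
    right_inv q := Qtilde.ext fun c x => by
      rw [Qtilde.dualLin_ofNat]
      refine (congrArg (fun φ => C.counit (RComod.Hom.lin φ x))
        (Qtilde.cofreeCounit_toNat hE q C.regular c)).trans ?_
      exact Qtilde.counit_lin_hom_regular q c x }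

end UV

/-! ### The composites of natural transformations in terms of `v`, `u`, `p` and `q`. -/

section Formulas

variable {k A L : Type u} [CommRing k] [Ring A] [Algebra k A] [Ring L] [Algebra k L]
  {C : Coring k A} {D : Coring k L} {S : BiComod L C}

/-- Trace `id ⊗ d`: the transformation of `v` sends it to `v(d₁) ⊗ d₂`, and that of `v'` followed by
the counit gives `v(d₁) ∘ v'(d₂)`. -/
theorem ofNat_toNat_comp_toNat (v v' : LHomL D S) (d : D.carrier) :
    (LHomL.ofNat (LHomL.toNat v ≫ LHomL.toNat v')).1 d = formulaVV v v' d := by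
  refine (LHomL.cofreeCounit_toNat v' S.toRComod _).trans ?_
  refine (congrArg (LHomL.precomp v' S.toRComod) (LHomL.lin_toNat_tmul v _ _ d)).trans ?_
  unfold formulaVV
  generalize D.comul d = w
  induction w using BalTensor.induction with
  | zero => simp [tmul_zero]
  | add y z hy hz => simp only [tmul_add, map_add, hy, hz]
  | tmul c d =>
    rw [assoc_symm_tmul, mapLeft_tmul, LHomL.precomp_tmul, LHomL.precomp_tmul, Category.comp_id,
      lift_tmul, LinearMap.mk₂_apply]

variable [Module Lᵐᵒᵖ C.carrier] [IsScalarTower k Lᵐᵒᵖ C.carrier] [SMulCommClass A Lᵐᵒᵖ C.carrier]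
  {E : CoringExtension C D} {hE : E.IsPure}

theorem colin_ofNat_toNat_comp (v : LHomL D S) (p : LHomD hE S) (d : D.carrier) :
    colin hE S (LHomD.ofNat (LHomL.toNat v ≫ LHomD.toNat p)).1 d = formulaVP v p d := by
  refine (congrArg (LHomD.eval p S.toRComod) (LHomL.lin_toNat_tmul v _ (𝟙 _) d)).trans ?_
  unfold formulaVP
  generalize D.comul d = w
  induction w using BalTensor.induction with
  | zero => simp [tmul_zero]; rfl
  | add y z hy hz =>
    simp only [tmul_add, map_add, hy, hz]
    rfl
  | tmul c d =>
    rw [assoc_symm_tmul, mapLeft_tmul, LHomL.precomp_tmul, Category.comp_id]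
    rfl

theorem colin_ofNat_toNat_comp_toNat (p : LHomD hE S) (u : EndCD E) (d : D.carrier) :
    colin hE S (LHomD.ofNat (LHomD.toNat p ≫ EndCD.toNat hE u)).1 d = formulaPU p u d := (rfl)

theorem lin_hom_regular_eq_contractLeft (q : Qtilde S) (c : C.carrier) (x : S.carrier) :
    RComod.Hom.lin (Qtilde.hom q C.regular c) x =
      contractLeft (dualLin S (q.1 c)) (dualLin_op_smul S (q.1 c)) (S.coact x) :=
  Qtilde.contractRight_comul q x c

/-- Trace `c` at the comodule `C`, whose induced coaction is the given one by `tau_regular`: it goes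
to `hom q (c₀) ⊗ c₁`, then to `hom q (c₀) ∘ v(c₁)`, and `ε` recovers `q(c₀)`. -/
theorem dualLin_ofNat_toNat_comp (q : Qtilde S) (v : LHomL D S) (c : C.carrier) (x : S.carrier) :
    dualLin S ((Qtilde.ofNat (Qtilde.toNat hE q ≫ LHomL.toNat v)).1 c) x =
      formulaQV E q v c x := by
  rw [Qtilde.dualLin_ofNat]
  refine (congrArg (fun φ => C.counit (RComod.Hom.lin φ x))
    (LHomL.cofreeCounit_toNat v C.regular (mapLeft (Qtilde.homRes E q C.regular)
      (Qtilde.homRes_op_smul q C.regular) (hE.tau C.regular (E.toRes c))))).trans ?_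
  rw [hE.tau_regular, mapLeft_mapLeft]
  unfold formulaQV
  generalize E.coact c = w
  induction w using BalTensor.induction with
  | zero =>
    simp only [map_zero, RComod.Hom.lin_zero, LinearMap.zero_apply]
    exact map_zero C.counit
  | add y z hy hz =>
    rw [map_add, map_add, map_add, RComod.Hom.lin_add, LinearMap.add_apply, ← hy, ← hz]
    exact map_add C.counit _ _
  | tmul c d => exact Qtilde.counit_lin_hom_regular q c (RComod.Hom.lin (v.1 d) x)

theorem ofNat_toNat_comp_toNat_apply (u : EndCD E) (q : Qtilde S) (c : C.carrier) :
    (Qtilde.ofNat (EndCD.toNat hE u ≫ Qtilde.toNat hE q)).1 c = q.1 (endLin E u.1 c) :=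
  LinearMap.ext fun x => by
    refine (Qtilde.dualLin_ofNat _ c x).trans ?_
    refine (congrArg (fun φ => C.counit (RComod.Hom.lin φ x))
      (Qtilde.cofreeCounit_toNat hE q C.regular (EndCD.onRes u C.regular c))).trans ?_
    refine (Qtilde.counit_lin_hom_regular q _ x).trans ?_
    exact congrArg (fun c => dualLin S (q.1 c) x) (EndCD.onComod_regular u c)

/-- At `C` the element `c` goes to `hom q (c₀) ⊗ c₁` and then to `hom q (c₀)` evaluated at `p(c₁)`,
which the defining equation of `Q̃` rewrites as `q(c₀)(p(c₁)⁰) p(c₁)¹`. -/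
theorem endLin_ofNat_toNat_comp (q : Qtilde S) (p : LHomD hE S) (c : C.carrier) :
    endLin E (EndCD.ofNat (Qtilde.toNat hE q ≫ LHomD.toNat p)).1 c = formulaQPAlt q p c := by
  change LHomD.eval p C.regular (mapLeft (Qtilde.homRes E q C.regular)
      (Qtilde.homRes_op_smul q C.regular) (hE.tau C.regular (E.toRes c))) = _
  rw [hE.tau_regular, mapLeft_mapLeft]
  unfold formulaQPAlt
  generalize E.coact c = w
  induction w using BalTensor.induction with
  | zero => rw [map_zero, map_zero, map_zero]; rfl
  | add y z hy hz =>
    rw [map_add, map_add, map_add, hy, hz]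
    rfl
  | tmul c d => exact lin_hom_regular_eq_contractLeft q c (colin hE S p.1 d)

/-- By the bicomodule condition, `c⁽¹⁾ ⊗ c⁽²⁾₀ ⊗ c⁽²⁾₁ = c₀⁽¹⁾ ⊗ c₀⁽²⁾ ⊗ c₁`. Contracting with `q`
and `p` gives `c₀⁽¹⁾ q(c₀⁽²⁾)(p(c₁))`, to which the equation defining `Q̃` applies. -/
theorem formulaQPAlt_eq_formulaQP (q : Qtilde S) (p : LHomD hE S) (c : C.carrier) :
    formulaQPAlt q p c = formulaQP q p c := by
  unfold formulaQP
  rw [contractRight_comp (evalQP q p) (fun a y => by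
    induction y using BalTensor.induction with
      | zero => simp
      | tmul c d =>
        rw [left_smul_tmul]
        exact Qtilde.evalAt_smul q (colin hE S p.1 d) a c
      | add y z hy hz => rw [smul_add, map_add, map_add, hy, hz, mul_add]) E.coact E.coact_smul,
    ← E.compat]
  unfold formulaQPAlt
  generalize E.coact c = w
  induction w using BalTensor.induction with
  | zero => simp
  | add y z hy hz => simp only [map_add, hy, hz]
  | tmul c d =>
    rw [lift_tmul, LinearMap.mk₂_apply, mapLeft_tmul, ← Qtilde.contractRight_comul]
    generalize C.comul c = z
    induction z using BalTensor.induction with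
    | zero => simp [zero_tmul]
    | add y z hy hz => simp only [add_tmul, map_add, hy, hz]
    | tmul c c' => rfl

theorem lin_ofNat_toNat_comp (p : LHomD hE S) (q : Qtilde S) (d : D.carrier) (x : S.carrier) :
    RComod.Hom.lin ((LHomL.ofNat (LHomD.toNat p ≫ Qtilde.toNat hE q)).1 d) x =
      formulaPQ p q d x :=
  congrArg (fun φ => RComod.Hom.lin φ x)
    (Qtilde.cofreeCounit_toNat hE q S.toRComod (LHomD.toRes p d))

end Formulas

end

end CoringMorita

/-! ### Assembly of the context and of the isomorphism. -/

theorem mainTheorem3 {k A L : Type u} [CommRing k] [Ring A] [Algebra k A] [Ring L] [Algebra k L]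
    (C : Coring k A) (D : Coring k L)
    [Module Lᵐᵒᵖ C.carrier] [IsScalarTower k Lᵐᵒᵖ C.carrier] [SMulCommClass A Lᵐᵒᵖ C.carrier]
    (E : CoringExtension C D) (hE : E.IsPure) (S : BiComod L C) :
    ∃ M : MoritaContext k (LHomL D S) (EndCD E) (LHomD hE S) (Qtilde S),
      (∀ (v v' : LHomL D S) (d : D.carrier), (M.mulR v v').1 d = formulaVV v v' d) ∧
      (∀ (u u' : EndCD E) (c : C.carrier),
        endLin E (M.mulS u u').1 c = endLin E u'.1 (endLin E u.1 c)) ∧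
      (∀ (v : LHomL D S) (p : LHomD hE S) (d : D.carrier),
        colin hE S (M.actRP v p).1 d = formulaVP v p d) ∧
      (∀ (p : LHomD hE S) (u : EndCD E) (d : D.carrier),
        colin hE S (M.actPS p u).1 d = formulaPU p u d) ∧
      (∀ (q : Qtilde S) (v : LHomL D S) (c : C.carrier) (x : S.carrier),
        dualLin S ((M.actQR q v).1 c) x = formulaQV E q v c x) ∧
      (∀ (u : EndCD E) (q : Qtilde S) (c : C.carrier),
        (M.actSQ u q).1 c = q.1 (endLin E u.1 c)) ∧
      (∀ (q : Qtilde S) (p : LHomD hE S) (c : C.carrier),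
        endLin E (M.pairQP q p).1 c = formulaQP q p c ∧
        endLin E (M.pairQP q p).1 c = formulaQPAlt q p c) ∧
      (∀ (p : LHomD hE S) (q : Qtilde S) (d : D.carrier) (x : S.carrier),
        RComod.Hom.lin ((M.pairPQ p q).1 d) x = formulaPQ p q d x) ∧
      Nonempty (M.Iso (MoritaContext.ofObjects k (S.V D) hE.U)) := by

  -- Each transported operation unfolds to `ofNat` of a composite of two `toNat`, which is the shape
  -- of the formula lemmas. What remains is the product of `C`-endomorphisms and the first of the
  -- two expressions for the pairing of `q` with `p`.
  refine ⟨(MoritaContext.ofObjects k (S.V D) hE.U).transport (natEquivVV D S) (natEquivUU hE)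
    (natEquivVU hE S) (natEquivUV S hE), ofNat_toNat_comp_toNat, fun u u' c => ?_,
    colin_ofNat_toNat_comp, colin_ofNat_toNat_comp_toNat, dualLin_ofNat_toNat_comp,
    ofNat_toNat_comp_toNat_apply, fun q p c => ⟨?_, endLin_ofNat_toNat_comp q p c⟩,
    lin_ofNat_toNat_comp, ⟨MoritaContext.transportIso _ _ _ _ _⟩⟩
  · refine (EndCD.onComod_regular u' _).trans ?_
    exact congrArg (endLin E u'.1) (EndCD.onComod_regular u c)
  · exact (endLin_ofNat_toNat_comp q p c).trans (formulaQPAlt_eq_formulaQP q p c)
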